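/- Conventions. Boxes of a Young diagram are indexed by (row, column), and the diagram is drawn with its top left corner at the origin; $D_m$ is the line $y=-x+m$, which passes diagonally through the boxes $(i,j)$ with $j-i=m$. A domino is a $1\times 2$ or $2\times 1$ rectangle of boxes; exactly one of its two boxes is crossed diagonally by a line $D_{2k}$, and the domino is said to lie on this $D_{2k}$. It has type 1 if that box is the right box of a horizontal domino or the top box of a vertical domino, and type 2 otherwise. A partition $\lambda$ is pavable if its diagram is a disjoint union of dominoes (a domino paving). A domino tableau of shape $\lambda$ is a filling of a domino paving of $\lambda$ with positive integers that weakly increase along rows and strictly increase down columns. A domino $F_2$ is weakly southeast of $F_1$ if some box of $F_2$ lies weakly below and weakly to the right of the top left box of $F_1$. A set-valued domino tableau of shape $\lambda$ is a filling of a domino paving of $\lambda$ with finite nonempty sets of positive integers such that (1) the minimum entries form a domino tableau, and (2) if $F_1,F_2$ are dominoes of the same type and $F_2$ is weakly southeast of $F_1$, then $\max(F_1)\le\min(F_2)$ if $F_1$ is on $D_{2k}$ and $F_2$ on $D_{2(k+1)}$, and $\max(F_1)<\min(F_2)$ if $F_1$ is on $D_{2(k+1)}$ and $F_2$ on $D_{2k}$.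 A semistandard set-valued tableau is a filling of the boxes of a partition with finite nonempty sets of positive integers, weakly increasing along rows ($\max A\le\min B$) and strictly increasing down columns ($\max A<\min B$). Diagonal reading words list the entries along each diagonal ($D_k$ for tableaux, $D_{2k}$ for domino tableaux) from northwest to southeast; the segment belonging to each diagonal is recorded. The 2-quotient $(\mu,\nu)$ of $\lambda=(\lambda_1,\dots,\lambda_p)$ (with $p$ positive parts) is defined as follows: let $L=(l_1,\dots,l_p)$, $l_i=\lambda_i+p-i$; from the even components of $L$ subtract, from right to left, $0,2,4,\dots$, halve and delete zeros to get $\mu$; from the odd components subtract, from right to left, $1,3,5,\dots$, halve and delete zeros to get $\nu$. Theorem. Let $\lambda$ be a pavable partition with $p$ parts and 2-quotient $(\mu,\nu)$. Put $(a,b)=(1,2)$ if $p$ is even and $(a,b)=(2,1)$ if $p$ is odd. There is a bijection $\Gamma^*$ from the set of set-valued domino tableaux of shape $\lambda$ to the set of pairs $(t_1,t_2)$ of semistandard set-valued tableaux of shapes $\mu$ and $\nu$ such that, if $\Gamma^*(T)=(t_1,t_2)$, then for every $k\in\mathbb Z$ the segment on $D_k$ of the diagonal reading word of $t_1$ (respectively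 $t_2$) is the segment on $D_{2k}$ of the diagonal reading word of $T$ restricted to the dominoes of type $a$ (respectively type $b$). There is likewise a bijection $\Gamma$, described by the same rule, from the domino tableaux of shape $\lambda$ to the pairs of semistandard Young tableaux (with positive entries) of shapes $\mu$ and $\nu$. Moreover $\Gamma^*$ extends $\Gamma$: replacing the entries of a domino tableau $S$ by singletons gives a set-valued domino tableau, whose image under $\Gamma^*$ is the pair $\Gamma(S)$ with its entries replaced by singletons. -/

import Mathlib

/-! Partitions are Mathlib's `YoungDiagram`s.  The box in row `i` and column `j` (both counted from
`0`, rows downwards) is the pair `(i, j)`.  Boxes are drawn in the plane with the top left corner of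
the diagram at the origin, so the line `D_m : y = -x + m` passes diagonally through exactly the
boxes `(i, j)` with `j - i = m`. -/

/-- The index `m` of the line `D_m : y = -x + m` that passes diagonally through the box `c`. -/
def content (c : ℕ × ℕ) : ℤ := (c.2 : ℤ) - (c.1 : ℤ)

/-- The boxes of `lam` on the line `D_m`, listed from northwest to southeast.  The boxes of the
quadrant on `D_m` are `(n + m⁻, n + m⁺)` for `n = 0, 1, 2, …`. -/
def diagBoxes (lam : YoungDiagram) (m : ℤ) : List (ℕ × ℕ) :=
  ((List.range lam.card).map fun n => (n + (-m).toNat, n + m.toNat)).filter fun c => c ∈ lam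

/-! ### Dominoes and pavings -/

/-- A domino: its top left box is `(row, col)`, and it is `1 × 2` if `horizontal` is `true` and
`2 × 1` otherwise. -/
@[ext] structure Domino where
  row : ℕ
  col : ℕ
  horizontal : Bool
deriving DecidableEq

/-- The top left box of a domino. -/
def Domino.fstBox (d : Domino) : ℕ × ℕ := (d.row, d.col)

/-- The other box of a domino: the right one, or the bottom one. -/
def Domino.sndBox (d : Domino) : ℕ × ℕ :=
  if d.horizontal then (d.row, d.col + 1) else (d.row + 1, d.col)

/-- The two boxes of a domino. -/
def Domino.boxes (d : Domino) : Finset (ℕ × ℕ) := {d.fstBox, d.sndBox}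

/-- The domino `d` lies on the line `D_{2k}`: one of its boxes is crossed by it diagonally. -/
def Domino.OnDiag (d : Domino) (k : ℤ) : Prop := ∃ c ∈ d.boxes, content c = 2 * k

/-- The type (`1` or `2`) of a domino.  The line `D_{2k}` that crosses the domino diagonally cuts
off a small triangle.  It points upward (type `1`) if the line is the diagonal of the top box of a
vertical domino or of the right box of a horizontal domino; otherwise the line is the diagonal of
the bottom box or of the left box, and the triangle points downward (type `2`). -/
def Domino.type (d : Domino) : ℕ :=
  if Even (content (if d.horizontal then d.sndBox else d.fstBox)) then 1 else 2

/-- `F₂` is weakly southeast of `F₁`: some box of `F₂` lies weakly below and weakly to the right of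
the top left box of `F₁`. -/
def Domino.WeaklySoutheast (F₂ F₁ : Domino) : Prop :=
  ∃ c ∈ F₂.boxes, F₁.row ≤ c.1 ∧ F₁.col ≤ c.2

/-- A domino paving of `lam`: a set of dominoes contained in `lam` such that every box of `lam` is
in exactly one of them. -/
def IsPaving (lam : YoungDiagram) (P : Finset Domino) : Prop :=
  (∀ d ∈ P, d.boxes ⊆ lam.cells) ∧ ∀ c ∈ lam, ∃! d, d ∈ P ∧ c ∈ d.boxes

/-- A partition is pavable if it has a domino paving. -/
def Pavable (lam : YoungDiagram) : Prop := ∃ P, IsPaving lam P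

/-- The dominoes of the paving `P` of `lam` met when walking along `D_{2k}` from northwest to
southeast (each box on the line contributes the one domino that contains it). -/
noncomputable def dominoesOnDiag (lam : YoungDiagram) (P : Finset Domino) (k : ℤ) : List Domino :=
  (diagBoxes lam (2 * k)).flatMap fun c => (P.filter fun d => c ∈ d.boxes).toList

/-- The numbers `f d` weakly increase from left to right along rows and strictly increase from top
to bottom down columns. -/
def IsDominoFilling (P : Finset Domino) (f : Domino → ℕ) : Prop :=
  (∀ d ∈ P, ∀ e ∈ P, ∀ i j₁ j₂ : ℕ, (i, j₁) ∈ d.boxes → (i, j₂) ∈ e.boxes → j₁ < j₂ →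
    f d ≤ f e) ∧
  (∀ d ∈ P, ∀ e ∈ P, ∀ i₁ i₂ j : ℕ, (i₁, j) ∈ d.boxes → (i₂, j) ∈ e.boxes → i₁ < i₂ → d ≠ e →
    f d < f e)

/-! ### Orders on sets of integers -/

/-- For nonempty sets this is `max A ≤ min B`. -/
def SetLE (A B : Finset ℕ) : Prop := ∀ a ∈ A, ∀ b ∈ B, a ≤ b

/-- For nonempty sets this is `max A < min B`. -/
def SetLT (A B : Finset ℕ) : Prop := ∀ a ∈ A, ∀ b ∈ B, a < b

/-- The minimum of a nonempty set (and `0` for the empty set). -/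
def minEntry (A : Finset ℕ) : ℕ := if h : A.Nonempty then A.min' h else 0

/-! ### The four kinds of tableaux

Fillings are total functions that are required to be trivial (`0` or `∅`) outside the shape, so
that two tableaux are equal exactly when they agree on the shape. -/

/-- A domino tableau of shape `lam`: a domino paving of `lam` filled with positive integers, weakly
increasing along rows and strictly increasing down columns. -/
@[ext] structure DominoTableau (lam : YoungDiagram) where
  tiles : Finset Domino
  entry : Domino → ℕ
  isPaving : IsPaving lam tiles
  pos : ∀ d ∈ tiles, 0 < entry d
  isFilling : IsDominoFilling tiles entry
  zeros : ∀ d, d ∉ tiles → entry d = 0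

/-- A set-valued domino tableau of shape `lam`. -/
@[ext] structure SetValuedDominoTableau (lam : YoungDiagram) where
  tiles : Finset Domino
  entry : Domino → Finset ℕ
  isPaving : IsPaving lam tiles
  nonempty : ∀ d ∈ tiles, (entry d).Nonempty
  pos : ∀ d ∈ tiles, ∀ a ∈ entry d, 0 < a
  /-- The minimum entries form a domino tableau. -/
  min_isFilling : IsDominoFilling tiles fun d => minEntry (entry d)
  weak : ∀ F₁ ∈ tiles, ∀ F₂ ∈ tiles, ∀ k : ℤ, F₁.type = F₂.type → F₂.WeaklySoutheast F₁ →
    F₁.OnDiag k → F₂.OnDiag (k + 1) → SetLE (entry F₁) (entry F₂)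
  strict : ∀ F₁ ∈ tiles, ∀ F₂ ∈ tiles, ∀ k : ℤ, F₁.type = F₂.type → F₂.WeaklySoutheast F₁ →
    F₁.OnDiag (k + 1) → F₂.OnDiag k → SetLT (entry F₁) (entry F₂)
  empties : ∀ d, d ∉ tiles → entry d = ∅

/-- Semistandard Young tableaux of shape `mu` with positive entries. -/
def PosSSYT (mu : YoungDiagram) : Type :=
  {t : SemistandardYoungTableau mu // ∀ i j, (i, j) ∈ mu → 0 < t i j}

/-- A semistandard set-valued tableau of shape `mu`: the boxes of `mu` are filled with finite
nonempty sets of positive integers, weakly increasing along rows and strictly increasing down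
columns. -/
@[ext] structure SetValuedTableau (mu : YoungDiagram) where
  entry : ℕ → ℕ → Finset ℕ
  nonempty : ∀ i j, (i, j) ∈ mu → (entry i j).Nonempty
  pos : ∀ i j, (i, j) ∈ mu → ∀ a ∈ entry i j, 0 < a
  row_weak : ∀ i j₁ j₂ : ℕ, j₁ < j₂ → (i, j₂) ∈ mu → SetLE (entry i j₁) (entry i j₂)
  col_strict : ∀ i₁ i₂ j : ℕ, i₁ < i₂ → (i₂, j) ∈ mu → SetLT (entry i₁ j) (entry i₂ j)
  empties : ∀ i j, (i, j) ∉ mu → entry i j = ∅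

/-! ### Diagonal reading words

A diagonal reading word is given by its segments, indexed by the diagonals. -/

/-- The segment on `D_k` of the diagonal reading word of a semistandard Young tableau. -/
def PosSSYT.reading {mu : YoungDiagram} (t : PosSSYT mu) (k : ℤ) : List ℕ :=
  (diagBoxes mu k).map fun c => t.1 c.1 c.2

/-- The segment on `D_k` of the diagonal reading word of a set-valued tableau. -/
def SetValuedTableau.reading {mu : YoungDiagram} (t : SetValuedTableau mu) (k : ℤ) :
    List (Finset ℕ) :=
  (diagBoxes mu k).map fun c => t.entry c.1 c.2

/-- The segment on `D_{2k}` of the diagonal reading word of a domino tableau, restricted to the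
entries of the dominoes of type `s`. -/
noncomputable def DominoTableau.reading {lam : YoungDiagram} (T : DominoTableau lam)
    (s : ℕ) (k : ℤ) : List ℕ :=
  ((dominoesOnDiag lam T.tiles k).filter fun d => d.type = s).map T.entry

/-- The segment on `D_{2k}` of the diagonal reading word of a set-valued domino tableau, restricted
to the entries of the dominoes of type `s`. -/
noncomputable def SetValuedDominoTableau.reading {lam : YoungDiagram}
    (T : SetValuedDominoTableau lam) (s : ℕ) (k : ℤ) : List (Finset ℕ) :=
  ((dominoesOnDiag lam T.tiles k).filter fun d => d.type = s).map T.entry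

/-! ### The 2-quotient -/

/-- The list `L = (l_1, …, l_k)` with `l_i = λ_i + k - i`, where `k` is the number of parts
(below, `i` counts from `0`). -/
def betaList (lam : YoungDiagram) : List ℕ :=
  lam.rowLens.mapIdx fun i x => x + (lam.rowLens.length - (i + 1))

/-- The components of `L` that are congruent to `a` modulo `2`. -/
def betaPart (lam : YoungDiagram) (a : ℕ) : List ℕ :=
  (betaList lam).filter fun l => l % 2 = a

/-- The components of `M` in the places of `betaPart lam a`: from right to left they are
`a, a + 2, a + 4, …`. -/
def replacedPart (lam : YoungDiagram) (a : ℕ) : List ℕ :=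
  ((List.range (betaPart lam a).length).map fun n => 2 * n + a).reverse

/-- Half the differences of the components congruent to `a`, with the zeros deleted. -/
def quotientParts (lam : YoungDiagram) (a : ℕ) : List ℕ :=
  (List.zipWith (fun l m => (l - m) / 2) (betaPart lam a) (replacedPart lam a)).filter
    fun x => x ≠ 0

theorem betaList_sortedGT (lam : YoungDiagram) : (betaList lam).SortedGT := by
  rw [List.sortedGT_iff_pairwise, List.pairwise_iff_getElem]
  intro i j hi hj hij
  have hs := lam.rowLens_sorted.pairwise
  rw [List.pairwise_iff_getElem] at hs
  simp only [betaList, List.length_mapIdx] at hi hj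
  have := hs i j hi hj hij
  simp only [betaList, List.getElem_mapIdx]
  omega

theorem quotientParts_sortedGE (lam : YoungDiagram) (a : ℕ) :
    (quotientParts lam a).SortedGE := by
  have hb : (betaPart lam a).Pairwise (· > ·) := (betaList_sortedGT lam).pairwise.filter _
  have hmod : ∀ x ∈ betaPart lam a, x % 2 = a := by
    intro x hx
    simpa using (List.mem_filter.1 hx).2
  rw [List.sortedGE_iff_pairwise]
  apply List.Pairwise.filter
  rw [← List.sortedGE_iff_pairwise, List.sortedGE_iff_isChain, List.isChain_iff_getElem]
  intro i hi
  simp only [List.length_zipWith, replacedPart, List.length_reverse, List.length_map,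
    List.length_range, min_self] at hi
  rw [List.pairwise_iff_getElem] at hb
  have h1 := hb i (i + 1) (by omega) hi (by omega)
  have h2 := hmod _ (List.getElem_mem (h := (by omega : i < (betaPart lam a).length)))
  have h3 := hmod _ (List.getElem_mem (h := hi))
  simp only [List.getElem_zipWith, replacedPart, List.getElem_reverse, List.getElem_map,
    List.getElem_range, List.length_map, List.length_range]
  omega

/-- The 2-quotient `(μ, ν)` of a partition: `μ` comes from the even components and `ν` from the odd
components. -/
def twoQuotient (lam : YoungDiagram) : YoungDiagram × YoungDiagram :=
  (YoungDiagram.ofRowLens (quotientParts lam 0) (quotientParts_sortedGE lam 0),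
   YoungDiagram.ofRowLens (quotientParts lam 1) (quotientParts_sortedGE lam 1))

/-- The type of the dominoes that correspond to the first component `μ` of the 2-quotient, which
depends on the parity of the number of parts of `lam`. -/
def muType (lam : YoungDiagram) : ℕ := if Even lam.rowLens.length then 1 else 2

/-- The type of the dominoes that correspond to the second component `ν` of the 2-quotient. -/
def nuType (lam : YoungDiagram) : ℕ := if Even lam.rowLens.length then 2 else 1

/-!
A domino meets two consecutive diagonals `D_{m-1}` and `D_m`.  The parity of `m = Domino.topDiag`
is its type and `⌊m / 2⌋` is the index `k` of its line `D_{2k}`, so that splitting a reading word by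
type amounts to recording the entries of the dominoes for each `m`.  If `N_m` is the number of
dominoes with a given `m`, the diagonal `D_m` has `N_m + N_{m+1}` boxes.  Hence
`N_m - N_{m+2}` is the difference of consecutive diagonal lengths of the shape.  Since a sequence of
diagonal lengths is that of a Young diagram exactly when its steps are `0` or `1` in the right
direction (`DiagSteps`), the numbers `N_{2k}` and `N_{2k+1}` are the diagonal lengths of two Young
diagrams.  These are the components of the 2-quotient (`Pavable.hasTwoQuotient`): in the list `L`,
the steps of the diagonal lengths are read off from which numbers occur.

The same is true for sublevel sets.  Order the dominoes of a domino tableau by their *keys*, that is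
by the entry and then by `m`.  The entries increase to the southeast, and so do the keys, so the
dominoes with key at most `x` pave a Young diagram.  So the set of keys is `Interlaced`: at every
threshold the numbers `N_m` have the steps of diagonal lengths of Young diagrams.  Semistandard
tableaux of the two shapes also have interlaced keys.  Conversely an interlaced set of keys of the
right size comes from exactly one domino tableau (`exists_dominoFilling`,
`IsDominoFilling.eq_of_image_key_eq`), and from a pair of semistandard tableaux
(`exists_semistandardFilling`): put the keys that belong to a diagonal there in increasing order.
The words of one type on one line strictly increase, so they carry the same information as the set
of keys.

Set-valued tableaux are treated as tableaux of their minima with labels attached.  For dominoes of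
the same type on consecutive lines `D_{2k}`, `D_{2(k+1)}`, the southeast relation is decided by the
minima (`IsDominoFilling.southeast_iff`), and so is the position of two boxes on consecutive
diagonals of a semistandard tableau.  Therefore the conditions on the remaining entries correspond
to each other.
-/

open Finset

/-! ### Young diagrams and their diagonals -/

/-- The box number `n` (from `0`, northwest to southeast) on the line `D_m` of the quadrant. -/
def diagBox (m : ℤ) (n : ℕ) : ℕ × ℕ := (n + (-m).toNat, n + m.toNat)

/-- The number of the box `c` on its diagonal. -/
def diagIndex (c : ℕ × ℕ) : ℕ := min c.1 c.2

/-- The number of boxes of `lam` on the line `D_m`. -/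
def diagLength (lam : YoungDiagram) (m : ℤ) : ℕ := #{c ∈ lam.cells | content c = m}

/-- `1` if `m < 0` and `0` otherwise: along the rim of a diagram the diagonal lengths grow by
`0` or `1` from one negative diagonal to the next, and shrink by `0` or `1` from then on. -/
def negStep (m : ℤ) : ℕ := if m < 0 then 1 else 0

/-- `D` behaves like the sequence of diagonal lengths of a Young diagram. -/
def DiagSteps (D : ℤ → ℕ) : Prop :=
  ∀ m, D (m + 1) ≤ D m + negStep m ∧ D m + negStep m ≤ D (m + 1) + 1

theorem negStep_cases (m : ℤ) : m < 0 ∧ negStep m = 1 ∨ 0 ≤ m ∧ negStep m = 0 := by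
  unfold negStep; split_ifs <;> omega

theorem content_diagBox (m : ℤ) (n : ℕ) : content (diagBox m n) = m := by
  simp only [content, diagBox]; omega

theorem diagIndex_diagBox (m : ℤ) (n : ℕ) : diagIndex (diagBox m n) = n := by
  simp only [diagIndex, diagBox]; omega

theorem diagBox_content_diagIndex (c : ℕ × ℕ) : diagBox (content c) (diagIndex c) = c := by
  ext <;> simp only [content, diagIndex, diagBox] <;> omega

theorem eq_of_content_eq_of_diagIndex_eq {c c' : ℕ × ℕ} (h : content c = content c')
    (h' : diagIndex c = diagIndex c') : c = c' := by
  rw [← diagBox_content_diagIndex c, h, h', diagBox_content_diagIndex]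

theorem le_iff_diagIndex_le {c c' : ℕ × ℕ} (h : content c = content c') :
    c ≤ c' ↔ diagIndex c ≤ diagIndex c' := by
  simp only [content, diagIndex, Prod.le_def] at *; omega

theorem eq_range_card_of_lower {s : Finset ℕ} (h : ∀ a ∈ s, ∀ b < a, b ∈ s) :
    s = range (#s) := by
  refine Finset.eq_of_subset_of_card_le (fun a ha => ?_) (by simp)
  have : range (a + 1) ⊆ s := fun b hb => by
    rcases Nat.lt_succ_iff_lt_or_eq.1 (mem_range.1 hb) with hb | rfl
    · exact h a ha b hb
    · exact ha
  simpa [Nat.succ_le_iff] using card_le_card this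

theorem image_diagIndex_eq_range (lam : YoungDiagram) (m : ℤ) :
    ({c ∈ lam.cells | content c = m}).image diagIndex = range (diagLength lam m) := by
  have hcard : #(({c ∈ lam.cells | content c = m}).image diagIndex) = diagLength lam m := by
    refine card_image_of_injOn fun c hc c' hc' h => ?_
    simp only [coe_filter, Set.mem_ofPred_eq] at hc hc'
    exact eq_of_content_eq_of_diagIndex_eq (hc.2.trans hc'.2.symm) h
  rw [← hcard]
  refine eq_range_card_of_lower fun a ha b hb => ?_
  obtain ⟨c, hc, rfl⟩ := mem_image.1 ha
  obtain ⟨hmem, rfl⟩ := mem_filter.1 hc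
  refine mem_image.2 ⟨diagBox (content c) b, mem_filter.2 ⟨?_, content_diagBox _ _⟩,
    diagIndex_diagBox _ _⟩
  refine lam.isLowerSet ?_ hmem
  rw [le_iff_diagIndex_le (content_diagBox _ _), diagIndex_diagBox]
  exact hb.le

theorem mem_iff_diagIndex_lt {lam : YoungDiagram} {c : ℕ × ℕ} :
    c ∈ lam ↔ diagIndex c < diagLength lam (content c) := by
  rw [← mem_range, ← image_diagIndex_eq_range, mem_image]
  constructor
  · intro h
    exact ⟨c, mem_filter.2 ⟨h, rfl⟩, rfl⟩
  · rintro ⟨c', hc', h⟩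
    obtain ⟨hc', h'⟩ := mem_filter.1 hc'
    rwa [← eq_of_content_eq_of_diagIndex_eq h' h]

theorem diagBox_mem_iff {lam : YoungDiagram} {m : ℤ} {n : ℕ} :
    diagBox m n ∈ lam ↔ n < diagLength lam m := by
  rw [mem_iff_diagIndex_lt, content_diagBox, diagIndex_diagBox]

theorem diagBoxes_eq (lam : YoungDiagram) (m : ℤ) :
    diagBoxes lam m = (List.range (diagLength lam m)).map (diagBox m) := by
  have hle : diagLength lam m ≤ lam.card := card_le_card (filter_subset _ _)
  obtain ⟨a, ha⟩ := Nat.exists_eq_add_of_le hle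
  have h1 : diagBoxes lam m =
      ((List.range lam.card).filter fun n => n < diagLength lam m).map (diagBox m) := by
    rw [diagBoxes, List.filter_map]
    congr 1
    refine List.filter_congr fun n _ => ?_
    simp only [Function.comp, decide_eq_decide]
    exact diagBox_mem_iff
  rw [h1, ha, List.range_add, List.filter_append, List.filter_eq_self.2, List.filter_eq_nil_iff.2,
    List.append_nil]
  · intro n hn
    obtain ⟨b, _, rfl⟩ := List.mem_map.1 hn
    simp
  · intro n hn
    simpa using hn

theorem mem_diagBoxes {lam : YoungDiagram} {m : ℤ} {c : ℕ × ℕ} :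
    c ∈ diagBoxes lam m ↔ c ∈ lam ∧ content c = m := by
  rw [diagBoxes_eq, List.mem_map]
  constructor
  · rintro ⟨n, hn, rfl⟩
    exact ⟨diagBox_mem_iff.2 (List.mem_range.1 hn), content_diagBox _ _⟩
  · rintro ⟨h, rfl⟩
    exact ⟨diagIndex c, List.mem_range.2 (mem_iff_diagIndex_lt.1 h), diagBox_content_diagIndex c⟩

theorem diagBoxes_pairwise (lam : YoungDiagram) (m : ℤ) :
    (diagBoxes lam m).Pairwise fun c c' => diagIndex c < diagIndex c' := by
  rw [diagBoxes_eq, List.pairwise_map]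
  simpa only [diagIndex_diagBox] using List.pairwise_lt_range

theorem diagSteps_diagLength (lam : YoungDiagram) : DiagSteps (diagLength lam) := by
  intro m
  constructor
  · by_contra! h
    have h1 : diagBox (m + 1) (diagLength lam m + negStep m) ∈ lam := diagBox_mem_iff.2 h
    have h2 : diagBox m (diagLength lam m) ≤ diagBox (m + 1) (diagLength lam m + negStep m) := by
      simp only [Prod.le_def, diagBox, negStep]; split_ifs <;> omega
    exact (diagBox_mem_iff.1 (lam.isLowerSet h2 h1)).false
  · by_contra! h
    have h1 : diagBox m (diagLength lam (m + 1) + 1 - negStep m) ∈ lam :=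
      diagBox_mem_iff.2 (by simp only [negStep] at *; split_ifs at * <;> omega)
    have h2 : diagBox (m + 1) (diagLength lam (m + 1)) ≤
        diagBox m (diagLength lam (m + 1) + 1 - negStep m) := by
      simp only [Prod.le_def, diagBox, negStep]; split_ifs <;> omega
    exact (diagBox_mem_iff.1 (lam.isLowerSet h2 h1)).false

/-- The boxes selected by a sequence with the steps of a Young diagram are closed under going
up and left. -/
theorem DiagSteps.lower {D : ℤ → ℕ} (hD : DiagSteps D) {c c' : ℕ × ℕ} (h : c ≤ c')
    (hc' : diagIndex c' < D (content c')) : diagIndex c < D (content c) := by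
  have left : ∀ i j : ℕ, diagIndex (i, j + 1) < D (content (i, j + 1)) →
      diagIndex (i, j) < D (content (i, j)) := by
    intro i j hij
    have h1 := (hD (content (i, j))).1
    have e : content (i, j + 1) = content (i, j) + 1 := by simp only [content]; omega
    rw [e] at hij
    have h2 : diagIndex (i, j + 1) = diagIndex (i, j) + negStep (content (i, j)) := by
      have := negStep_cases (content (i, j))
      simp only [content] at this
      simp only [diagIndex, content]
      omega
    omega
  have up : ∀ i j : ℕ, diagIndex (i + 1, j) < D (content (i + 1, j)) →
      diagIndex (i, j) < D (content (i, j)) := by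
    intro i j hij
    have h1 := (hD (content (i + 1, j))).2
    have e : content (i, j) = content (i + 1, j) + 1 := by simp only [content]; omega
    rw [e]
    have h2 : diagIndex (i + 1, j) + negStep (content (i + 1, j)) = diagIndex (i, j) + 1 := by
      have := negStep_cases (content (i + 1, j))
      simp only [content] at this
      simp only [diagIndex, content]
      omega
    omega
  obtain ⟨i, j⟩ := c
  obtain ⟨i', j'⟩ := c'
  obtain ⟨a, rfl⟩ := Nat.exists_eq_add_of_le h.1
  obtain ⟨b, rfl⟩ := Nat.exists_eq_add_of_le h.2
  clear h
  simp only at *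
  induction a with
  | zero =>
    induction b with
    | zero => exact hc'
    | succ b ih => exact ih (left _ _ hc')
  | succ a ih => exact ih (up _ _ hc')

/-! ### Monotone fillings and their sublevel sets -/

section Fillings

variable {κ : Type*} [LinearOrder κ]

/-- The boxes of `lam` on `D_m` whose key is at most `x`. -/
def levelCells (lam : YoungDiagram) (key : ℕ × ℕ → κ) (x : κ) (m : ℤ) : Finset (ℕ × ℕ) :=
  {c ∈ lam.cells | key c ≤ x ∧ content c = m}

/-- The keys weakly increase to the right and downwards. -/
def CellMonotone (lam : YoungDiagram) (key : ℕ × ℕ → κ) : Prop :=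
  ∀ c c' : ℕ × ℕ, c ≤ c' → c' ∈ lam → key c ≤ key c'

/-- A sublevel set of a monotone filling, which is again a Young diagram. -/
def CellMonotone.sublevel {lam : YoungDiagram} {key : ℕ × ℕ → κ} (h : CellMonotone lam key)
    (x : κ) : YoungDiagram where
  cells := {c ∈ lam.cells | key c ≤ x}
  isLowerSet := by
    intro c' c hc hc'
    simp only [coe_filter, Set.mem_ofPred_eq, YoungDiagram.mem_cells] at hc' ⊢
    exact ⟨lam.isLowerSet hc hc'.1, (h c c' hc hc'.1).trans hc'.2⟩

theorem CellMonotone.diagLength_sublevel {lam : YoungDiagram} {key : ℕ × ℕ → κ}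
    (h : CellMonotone lam key) (x : κ) (m : ℤ) :
    diagLength (h.sublevel x) m = #(levelCells lam key x m) := by
  rw [diagLength, levelCells, sublevel, filter_filter]

theorem CellMonotone.diagSteps {lam : YoungDiagram} {key : ℕ × ℕ → κ}
    (h : CellMonotone lam key) (x : κ) : DiagSteps fun m => #(levelCells lam key x m) := by
  have := diagSteps_diagLength (h.sublevel x)
  rwa [funext fun m => h.diagLength_sublevel x m] at this

theorem CellMonotone.le_iff {lam : YoungDiagram} {key : ℕ × ℕ → κ}
    (h : CellMonotone lam key) {c : ℕ × ℕ} (hc : c ∈ lam) (x : κ) :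
    key c ≤ x ↔ diagIndex c < #(levelCells lam key x (content c)) := by
  rw [← h.diagLength_sublevel, ← mem_iff_diagIndex_lt, ← YoungDiagram.mem_cells]
  simp [sublevel, hc]

/-- A monotone filling is determined by the sizes of its sublevel sets on the diagonals. -/
theorem CellMonotone.eq_of_card {lam : YoungDiagram} {key key' : ℕ × ℕ → κ}
    (h : CellMonotone lam key) (h' : CellMonotone lam key')
    (hcard : ∀ x m, #(levelCells lam key x m) = #(levelCells lam key' x m))
    {c : ℕ × ℕ} (hc : c ∈ lam) : key c = key' c := by
  apply le_antisymm
  · rw [h.le_iff hc, hcard, ← h'.le_iff hc]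
  · rw [h'.le_iff hc, ← hcard, ← h.le_iff hc]

theorem rank_lt_iff {A : Finset κ} {x y : κ} (hx : x ∈ A) :
    #{z ∈ A | z < x} < #{z ∈ A | z ≤ y} ↔ x ≤ y := by
  constructor
  · intro h
    by_contra! hlt
    refine h.not_ge (card_le_card fun z hz => ?_)
    simp only [mem_filter] at hz ⊢
    exact ⟨hz.1, hz.2.trans_lt hlt⟩
  · intro h
    refine card_lt_card ⟨fun z hz => ?_, fun hsub => ?_⟩
    · simp only [mem_filter] at hz ⊢
      exact ⟨hz.1, hz.2.le.trans h⟩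
    · have := hsub (mem_filter.2 ⟨hx, h⟩)
      simp at this

theorem rank_add_one {A : Finset κ} {x : κ} (hx : x ∈ A) :
    #{z ∈ A | z < x} + 1 = #{z ∈ A | z ≤ x} := by
  have : ({z ∈ A | z ≤ x} : Finset κ) = insert x {z ∈ A | z < x} := by
    ext z
    simp only [mem_filter, mem_insert, le_iff_lt_or_eq]
    constructor
    · tauto
    · rintro (rfl | h)
      · exact ⟨hx, Or.inr rfl⟩
      · tauto
  rw [this, card_insert_of_notMem (by simp)]

theorem exists_rank_eq {A : Finset κ} {n : ℕ} (hn : n < #A) :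
    ∃ x ∈ A, #{z ∈ A | z < x} = n := by
  have hinj : Set.InjOn (fun x => #{z ∈ A | z < x}) A := by
    intro x hx y hy hxy
    simp only at hxy
    apply le_antisymm
    · rw [← rank_lt_iff hx, hxy]
      exact (rank_lt_iff hy).2 le_rfl
    · rw [← rank_lt_iff hy, ← hxy]
      exact (rank_lt_iff hx).2 le_rfl
  have himg : A.image (fun x => #{z ∈ A | z < x}) = range #A := by
    refine Finset.eq_of_subset_of_card_le (fun n hn => ?_) (by simp [card_image_of_injOn hinj])
    obtain ⟨x, hx, rfl⟩ := mem_image.1 hn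
    refine mem_range.2 (card_lt_card ⟨filter_subset _ _, fun hsub => ?_⟩)
    simpa using hsub hx
  have := mem_range.2 hn
  rw [← himg] at this
  simpa using this

/-- Finite sets of keys, one for each diagonal, are the diagonals of a monotone filling as soon as
the sizes of their sublevel sets are those of Young diagrams: put the keys on each diagonal in
increasing order. -/
theorem exists_cellMonotone [Nonempty κ] {lam : YoungDiagram} {A : ℤ → Finset κ}
    (hA : ∀ x, DiagSteps fun m => #{z ∈ A m | z ≤ x}) (hcard : ∀ m, #(A m) = diagLength lam m) :
    ∃ key : ℕ × ℕ → κ, CellMonotone lam key ∧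
      (∀ c ∈ lam, key c ∈ A (content c) ∧ #{z ∈ A (content c) | z < key c} = diagIndex c) ∧
      ∀ m, ∀ x ∈ A m, ∃! c, c ∈ lam ∧ content c = m ∧ key c = x := by
  have hex : ∀ c : ℕ × ℕ, ∃ x, c ∈ lam →
      x ∈ A (content c) ∧ #{z ∈ A (content c) | z < x} = diagIndex c := by
    intro c
    by_cases hc : c ∈ lam
    · obtain ⟨x, hx, h⟩ := exists_rank_eq (A := A (content c)) (n := diagIndex c)
        (by rw [hcard]; exact mem_iff_diagIndex_lt.1 hc)
      exact ⟨x, fun _ => ⟨hx, h⟩⟩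
    · exact ⟨Classical.arbitrary κ, fun h => absurd h hc⟩
  choose key hkey using hex
  refine ⟨key, fun c c' hcc' hc' => ?_, hkey, fun m x hx => ?_⟩
  · have hc : c ∈ lam := lam.isLowerSet hcc' hc'
    rw [← rank_lt_iff (hkey c hc).1, (hkey c hc).2]
    refine (hA (key c')).lower hcc' ?_
    rw [← (hkey c' hc').2]
    exact (rank_lt_iff (hkey c' hc').1).2 le_rfl
  · have hlt : #{z ∈ A m | z < x} < diagLength lam m := by
      rw [← hcard]
      refine card_lt_card ⟨filter_subset _ _, fun hsub => ?_⟩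
      simpa using hsub hx
    have heq : ∀ y ∈ A m, #{z ∈ A m | z < y} = #{z ∈ A m | z < x} → y = x := by
      intro y hy h
      apply le_antisymm
      · rw [← rank_lt_iff hy, h]
        exact (rank_lt_iff hx).2 le_rfl
      · rw [← rank_lt_iff hx, ← h]
        exact (rank_lt_iff hy).2 le_rfl
    refine ⟨diagBox m #{z ∈ A m | z < x}, ⟨diagBox_mem_iff.2 hlt, content_diagBox _ _, ?_⟩, ?_⟩
    · have := hkey _ (diagBox_mem_iff.2 hlt)
      rw [content_diagBox, diagIndex_diagBox] at this
      exact heq _ this.1 this.2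
    · rintro c ⟨hc, rfl, rfl⟩
      rw [(hkey c hc).2, diagBox_content_diagIndex]

end Fillings

/-! ### Dominoes and the diagonals they meet -/

/-- The box of a domino on the larger of its two diagonals: the right or the top one. -/
def Domino.upperBox (d : Domino) : ℕ × ℕ := if d.horizontal then d.sndBox else d.fstBox

/-- The box of a domino on the smaller of its two diagonals: the left or the bottom one. -/
def Domino.lowerBox (d : Domino) : ℕ × ℕ := if d.horizontal then d.fstBox else d.sndBox

/-- The larger index of the two diagonals met by a domino.  Its parity gives the type of the
domino, and half of it, rounded down, the index `k` of the line `D_{2k}` the domino lies on. -/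
def Domino.topDiag (d : Domino) : ℤ := content d.upperBox

theorem Domino.boxes_eq (d : Domino) : d.boxes = {d.lowerBox, d.upperBox} := by
  unfold boxes lowerBox upperBox
  split_ifs
  · rfl
  · exact pair_comm _ _

theorem Domino.mem_boxes {d : Domino} {c : ℕ × ℕ} :
    c ∈ d.boxes ↔ c = d.lowerBox ∨ c = d.upperBox := by
  rw [d.boxes_eq]; simp

theorem Domino.content_upperBox (d : Domino) : content d.upperBox = d.topDiag := rfl

theorem Domino.content_lowerBox (d : Domino) : content d.lowerBox = d.topDiag - 1 := by
  obtain ⟨r, c, h⟩ := d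
  cases h <;> simp [topDiag, lowerBox, upperBox, content, fstBox, sndBox] <;> omega

theorem Domino.eq_upperBox {d : Domino} {c : ℕ × ℕ} (hc : c ∈ d.boxes)
    (h : content c = d.topDiag) : c = d.upperBox := by
  rcases mem_boxes.1 hc with rfl | rfl
  · rw [content_lowerBox] at h; omega
  · rfl

theorem Domino.eq_lowerBox {d : Domino} {c : ℕ × ℕ} (hc : c ∈ d.boxes)
    (h : content c = d.topDiag - 1) : c = d.lowerBox := by
  rcases mem_boxes.1 hc with rfl | rfl
  · rfl
  · rw [content_upperBox] at h; omega

theorem Domino.content_of_mem {d : Domino} {c : ℕ × ℕ} (hc : c ∈ d.boxes) :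
    content c = d.topDiag ∨ content c = d.topDiag - 1 := by
  rcases mem_boxes.1 hc with rfl | rfl
  · exact Or.inr d.content_lowerBox
  · exact Or.inl rfl

theorem Domino.box_unique {d : Domino} {c c' : ℕ × ℕ} (hc : c ∈ d.boxes) (hc' : c' ∈ d.boxes)
    (h : content c = content c') : c = c' := by
  rcases content_of_mem hc with h1 | h1
  · rw [eq_upperBox hc h1, eq_upperBox hc' (h.symm.trans h1)]
  · rw [eq_lowerBox hc h1, eq_lowerBox hc' (h.symm.trans h1)]

theorem Domino.type_eq (d : Domino) : d.type = if Even d.topDiag then 1 else 2 := rfl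

theorem Domino.onDiag_iff {d : Domino} {k : ℤ} :
    d.OnDiag k ↔ d.topDiag = 2 * k ∨ d.topDiag = 2 * k + 1 := by
  simp only [OnDiag, mem_boxes]
  constructor
  · rintro ⟨c, rfl | rfl, h⟩
    · rw [content_lowerBox] at h; omega
    · rw [content_upperBox] at h; omega
  · rintro (h | h)
    · exact ⟨_, Or.inr rfl, h⟩
    · exact ⟨_, Or.inl rfl, by rw [content_lowerBox]; omega⟩

theorem Domino.eq_of_boxes_subset {d e : Domino} (h : d.boxes ⊆ e.boxes) : d = e := by
  have h1 : d.fstBox ∈ e.boxes := h (by simp [boxes])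
  have h2 : d.sndBox ∈ e.boxes := h (by simp [boxes])
  obtain ⟨r, c, b⟩ := d
  obtain ⟨r', c', b'⟩ := e
  cases b <;> cases b' <;>
    simp only [boxes, mem_insert, mem_singleton, fstBox, sndBox, Prod.mk.injEq, Domino.mk.injEq,
      if_true, Bool.false_eq_true, if_false, and_true, reduceCtorEq, and_false] at * <;> omega

/-- Boxes on consecutive diagonals form a domino as soon as their numbers on these diagonals differ
by the right amount. -/
theorem exists_domino {c c' : ℕ × ℕ} (hcont : content c' = content c + 1)
    (hidx : diagIndex c' ≤ diagIndex c + negStep (content c))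
    (hidx' : diagIndex c + negStep (content c) ≤ diagIndex c' + 1) :
    ∃ d : Domino, d.lowerBox = c ∧ d.upperBox = c' := by
  obtain ⟨i, j⟩ := c
  obtain ⟨i', j'⟩ := c'
  have := negStep_cases (content (i, j))
  simp only [content, diagIndex] at *
  have : i' = i ∧ j' = j + 1 ∨ i = i' + 1 ∧ j' = j := by omega
  rcases this with ⟨rfl, rfl⟩ | ⟨rfl, rfl⟩
  · exact ⟨⟨i', j, true⟩, rfl, rfl⟩
  · exact ⟨⟨i', j', false⟩, rfl, rfl⟩

/-! ### Keys -/

/-- A key: an entry together with the index of a diagonal, ordered lexicographically. -/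
abbrev Key := ℕ ×ₗ ℤ

/-- The key with a given entry and diagonal. -/
def mkKey (v : ℕ) (m : ℤ) : Key := toLex (v, m)

/-- The entry of a key. -/
def Key.val (x : Key) : ℕ := (ofLex x).1

/-- The diagonal of a key. -/
def Key.diag (x : Key) : ℤ := (ofLex x).2

@[simp] theorem diag_mkKey (v : ℕ) (m : ℤ) : (mkKey v m).diag = m := rfl

@[simp] theorem mkKey_val_diag (x : Key) : mkKey x.val x.diag = x := rfl

theorem Key.le_iff {x y : Key} : x ≤ y ↔ x.val < y.val ∨ x.val = y.val ∧ x.diag ≤ y.diag :=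
  Prod.Lex.le_iff ..

theorem mkKey_le_iff {v v' : ℕ} {m m' : ℤ} :
    mkKey v m ≤ mkKey v' m' ↔ v < v' ∨ v = v' ∧ m ≤ m' := Key.le_iff

theorem mkKey_inj {v v' : ℕ} {m m' : ℤ} : mkKey v m = mkKey v' m' ↔ v = v' ∧ m = m' := by
  constructor
  · intro h
    exact ⟨congrArg Key.val h, congrArg Key.diag h⟩
  · rintro ⟨rfl, rfl⟩; rfl

/-- The number of keys in `K` on the diagonal `m` that are at most `x`. -/
def keyCount (K : Finset Key) (x : Key) (m : ℤ) : ℕ := #{z ∈ K | z ≤ x ∧ z.diag = m}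

/-- The counting form of the interlacing of the words on the diagonals `m` and `m + 2`, at all
thresholds. -/
def Interlaced (K : Finset Key) : Prop :=
  ∀ x m, keyCount K x (m + 2) ≤ keyCount K x m + negStep m ∧
    keyCount K x m + negStep m ≤ keyCount K x (m + 2) + 1

theorem exists_key_bound (K : Finset Key) : ∃ x : Key, ∀ z ∈ K, z ≤ x := K.exists_le

/-! ### Domino fillings as sets of keys -/

/-- The key of a domino in a filling. -/
def Domino.key (g : Domino → ℕ) (d : Domino) : Key := mkKey (g d) d.topDiag

open Classical in
/-- The domino of `P` that contains the box `c` (an arbitrary one if there is none). -/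
noncomputable def tileAt (P : Finset Domino) (c : ℕ × ℕ) : Domino :=
  if h : ∃ d ∈ P, c ∈ d.boxes then h.choose else ⟨0, 0, true⟩

section Paving

variable {lam : YoungDiagram} {P : Finset Domino} {g : Domino → ℕ}

theorem IsPaving.mem_of_mem_boxes (hP : IsPaving lam P) {d : Domino} (hd : d ∈ P) {c : ℕ × ℕ}
    (hc : c ∈ d.boxes) : c ∈ lam := hP.1 d hd hc

theorem IsPaving.eq_of_mem_boxes (hP : IsPaving lam P) {d e : Domino} (hd : d ∈ P) (he : e ∈ P)
    {c : ℕ × ℕ} (hc : c ∈ d.boxes) (hc' : c ∈ e.boxes) : d = e :=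
  (hP.2 c (hP.mem_of_mem_boxes hd hc)).unique ⟨hd, hc⟩ ⟨he, hc'⟩

theorem IsPaving.tileAt_mem (hP : IsPaving lam P) {c : ℕ × ℕ} (hc : c ∈ lam) :
    tileAt P c ∈ P ∧ c ∈ (tileAt P c).boxes := by
  have h : ∃ d ∈ P, c ∈ d.boxes := (hP.2 c hc).exists
  rw [tileAt, dif_pos h]
  exact h.choose_spec

theorem IsPaving.tileAt_eq (hP : IsPaving lam P) {d : Domino} (hd : d ∈ P) {c : ℕ × ℕ}
    (hc : c ∈ d.boxes) : tileAt P c = d :=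
  have h := hP.tileAt_mem (hP.mem_of_mem_boxes hd hc)
  hP.eq_of_mem_boxes h.1 hd h.2 hc

/-- Each box on `D_m` lies in a domino with boxes on `D_{m-1}` and `D_m` or in one with boxes on
`D_m` and `D_{m+1}`. -/
theorem IsPaving.card_filter_cells (hP : IsPaving lam P) (p : Domino → Prop) [DecidablePred p]
    (m : ℤ) : #{c ∈ lam.cells | p (tileAt P c) ∧ content c = m} =
      #{d ∈ P | p d ∧ d.topDiag = m} + #{d ∈ P | p d ∧ d.topDiag = m + 1} := by
  rw [← card_union_of_disjoint, ← filter_or]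
  · refine card_bij (fun c _ => tileAt P c) ?_ ?_ ?_
    · intro c hc
      obtain ⟨hmem, hx, rfl⟩ := mem_filter.1 hc
      obtain ⟨h1, h2⟩ := hP.tileAt_mem hmem
      refine mem_filter.2 ⟨h1, ?_⟩
      have := Domino.content_of_mem h2
      rcases this with h | h
      · exact Or.inl ⟨hx, h.symm⟩
      · exact Or.inr ⟨hx, by omega⟩
    · intro c hc c' hc' h
      obtain ⟨hc, hx, hm⟩ := mem_filter.1 hc
      obtain ⟨hc', hx', hm'⟩ := mem_filter.1 hc'
      have h1 := (hP.tileAt_mem hc).2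
      rw [h] at h1
      exact Domino.box_unique h1 (hP.tileAt_mem hc').2 (hm.trans hm'.symm)
    · intro d hd
      simp only [mem_filter] at hd
      obtain ⟨hd, h⟩ := hd
      rcases h with ⟨hx, rfl⟩ | ⟨hx, hm⟩
      · have hb : d.upperBox ∈ d.boxes := Domino.mem_boxes.2 (Or.inr rfl)
        refine ⟨d.upperBox, mem_filter.2 ⟨hP.1 d hd hb, ?_, rfl⟩, hP.tileAt_eq hd hb⟩
        simpa only [hP.tileAt_eq hd hb] using hx
      · have hb : d.lowerBox ∈ d.boxes := Domino.mem_boxes.2 (Or.inl rfl)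
        refine ⟨d.lowerBox, mem_filter.2 ⟨hP.1 d hd hb, ?_, ?_⟩, hP.tileAt_eq hd hb⟩
        · simpa only [hP.tileAt_eq hd hb] using hx
        · rw [Domino.content_lowerBox]; omega
  · refine disjoint_filter.2 fun d _ h h' => ?_
    omega

theorem IsDominoFilling.le_of_row (hP : IsPaving lam P) (hg : IsDominoFilling P g)
    {d e : Domino} (hd : d ∈ P) (he : e ∈ P) {i j j' : ℕ} (hc : (i, j) ∈ d.boxes)
    (hc' : (i, j') ∈ e.boxes) (h : j ≤ j') : g d ≤ g e := by
  rcases h.lt_or_eq with h | rfl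
  · exact hg.1 d hd e he i j j' hc hc' h
  · rw [hP.eq_of_mem_boxes hd he hc hc']

theorem IsDominoFilling.le_of_col (hP : IsPaving lam P) (hg : IsDominoFilling P g)
    {d e : Domino} (hd : d ∈ P) (he : e ∈ P) {i i' j : ℕ} (hc : (i, j) ∈ d.boxes)
    (hc' : (i', j) ∈ e.boxes) (h : i ≤ i') : g d < g e ∨ d = e := by
  by_cases hde : d = e
  · exact Or.inr hde
  rcases h.lt_or_eq with h | rfl
  · exact Or.inl (hg.2 d hd e he i i' j hc hc' h hde)
  · exact absurd (hP.eq_of_mem_boxes hd he hc hc') hde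

/-- Keys of dominoes weakly increase towards the southeast: along a row the entry weakly increases
and the diagonal grows, and down a column the entry grows unless the domino stays the same. -/
theorem IsDominoFilling.key_le (hP : IsPaving lam P) (hg : IsDominoFilling P g)
    {d e : Domino} (hd : d ∈ P) (he : e ∈ P) {c c' : ℕ × ℕ} (hc : c ∈ d.boxes)
    (hc' : c' ∈ e.boxes) (h : c ≤ c') : d.key g ≤ e.key g := by
  obtain ⟨i, j⟩ := c
  obtain ⟨i', j'⟩ := c'
  have hm : (i, j') ∈ lam :=
    lam.isLowerSet (Prod.mk_le_mk.2 ⟨h.1, le_rfl⟩) (hP.mem_of_mem_boxes he hc')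
  obtain ⟨hfP, hf⟩ := hP.tileAt_mem hm
  set f := tileAt P (i, j')
  have h1 : d.key g ≤ f.key g := by
    by_cases hjj : j = j'
    · subst hjj
      rw [hP.eq_of_mem_boxes hd hfP hc hf]
    · have hlt : j < j' := lt_of_le_of_ne h.2 hjj
      have := hg.le_of_row hP hd hfP hc hf h.2
      have h2 := Domino.content_of_mem hc
      have h3 := Domino.content_of_mem hf
      simp only [content] at h2 h3
      rw [Domino.key, Domino.key, mkKey_le_iff]
      omega
  refine h1.trans ?_
  rcases hg.le_of_col hP hfP he hf hc' h.1 with h2 | h2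
  · exact mkKey_le_iff.2 (Or.inl h2)
  · rw [h2]

/-- The keys of the dominoes, as a filling of the boxes, increase. -/
theorem IsDominoFilling.cellMonotone (hP : IsPaving lam P) (hg : IsDominoFilling P g) :
    CellMonotone lam fun c => (tileAt P c).key g := by
  intro c c' h hc'
  obtain ⟨h1, h2⟩ := hP.tileAt_mem (lam.isLowerSet h hc')
  obtain ⟨h3, h4⟩ := hP.tileAt_mem hc'
  exact hg.key_le hP h1 h3 h2 h4 h

/-- Dominoes of the same type on the same line `D_{2k}` have entries that strictly increase from
northwest to southeast. -/
theorem IsDominoFilling.lt_of_diagIndex_lt (hP : IsPaving lam P) (hg : IsDominoFilling P g)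
    {d e : Domino} (hd : d ∈ P) (he : e ∈ P) (ht : d.topDiag = e.topDiag) {c c' : ℕ × ℕ}
    (hc : c ∈ d.boxes) (hc' : c' ∈ e.boxes) (hcont : content c = content c')
    (h : diagIndex c < diagIndex c') : g d < g e := by
  obtain ⟨i, j⟩ := c
  obtain ⟨i', j'⟩ := c'
  have hij : i < i' ∧ j < j' ∧ (j : ℤ) - i = j' - i' := by
    simp only [content, diagIndex] at *; omega
  have hmem := hP.mem_of_mem_boxes he hc'
  -- A path from one box to the other leaves the diagonals of the two dominoes at its corner.
  rcases Domino.content_of_mem hc with h1 | h1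
  · have hm : (i, j') ∈ lam := lam.isLowerSet (Prod.mk_le_mk.2 ⟨hij.1.le, le_rfl⟩) hmem
    obtain ⟨hfP, hf⟩ := hP.tileAt_mem hm
    have h2 := hg.le_of_row hP hd hfP hc hf hij.2.1.le
    rcases hg.le_of_col hP hfP he hf hc' hij.1.le with h3 | h3
    · omega
    · rw [h3] at hf
      have := Domino.content_of_mem hf
      simp only [content] at *
      omega
  · have hm : (i', j) ∈ lam := lam.isLowerSet (Prod.mk_le_mk.2 ⟨le_rfl, hij.2.1.le⟩) hmem
    obtain ⟨hfP, hf⟩ := hP.tileAt_mem hm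
    have h2 := hg.le_of_row hP hfP he hf hc' hij.2.1.le
    rcases hg.le_of_col hP hd hfP hc hf hij.1.le with h3 | h3
    · omega
    · rw [← h3] at hf
      have := Domino.content_of_mem hf
      simp only [content] at *
      omega

theorem IsDominoFilling.key_injOn (hP : IsPaving lam P) (hg : IsDominoFilling P g)
    {d e : Domino} (hd : d ∈ P) (he : e ∈ P) (h : d.key g = e.key g) : d = e := by
  obtain ⟨hv, ht⟩ := mkKey_inj.1 h
  have hcd : d.upperBox ∈ d.boxes := Domino.mem_boxes.2 (Or.inr rfl)
  have hce : e.upperBox ∈ e.boxes := Domino.mem_boxes.2 (Or.inr rfl)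
  rcases lt_trichotomy (diagIndex d.upperBox) (diagIndex e.upperBox) with hlt | heq | hlt
  · exact absurd hv (hg.lt_of_diagIndex_lt hP hd he ht hcd hce ht hlt).ne
  · refine hP.eq_of_mem_boxes hd he hcd ?_
    rwa [eq_of_content_eq_of_diagIndex_eq ht heq]
  · exact absurd hv (hg.lt_of_diagIndex_lt hP he hd ht.symm hce hcd ht.symm hlt).ne'

theorem IsDominoFilling.keyCount_image (hP : IsPaving lam P) (hg : IsDominoFilling P g) (x : Key)
    (m : ℤ) : keyCount (P.image (Domino.key g)) x m = #{d ∈ P | d.key g ≤ x ∧ d.topDiag = m} := by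
  rw [keyCount, filter_image, card_image_of_injOn]
  · rfl
  · intro d hd e he h
    simp only [coe_filter, Set.mem_ofPred_eq] at hd he
    exact hg.key_injOn hP hd.1 he.1 h

theorem IsDominoFilling.card_levelCells (hP : IsPaving lam P) (hg : IsDominoFilling P g) (x : Key)
    (m : ℤ) : #(levelCells lam (fun c => (tileAt P c).key g) x m) =
      keyCount (P.image (Domino.key g)) x m + keyCount (P.image (Domino.key g)) x (m + 1) := by
  rw [hg.keyCount_image hP, hg.keyCount_image hP]
  exact hP.card_filter_cells (fun d => d.key g ≤ x) m

/-- The keys of a domino tableau interlace: this is the shape of its sublevel diagrams. -/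
theorem IsDominoFilling.interlaced (hP : IsPaving lam P) (hg : IsDominoFilling P g) :
    Interlaced (P.image (Domino.key g)) := by
  intro x m
  have := (hg.cellMonotone hP).diagSteps x m
  simp only [hg.card_levelCells hP] at this
  rw [show m + 1 + 1 = m + 2 by ring] at this
  omega

theorem IsDominoFilling.diagLength_eq (hP : IsPaving lam P) (hg : IsDominoFilling P g) (m : ℤ) :
    diagLength lam m = #{z ∈ P.image (Domino.key g) | z.diag = m} +
      #{z ∈ P.image (Domino.key g) | z.diag = m + 1} := by
  obtain ⟨x, hx⟩ := exists_key_bound (P.image (Domino.key g))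
  have h1 := hg.card_levelCells hP x m
  have h2 : levelCells lam (fun c => (tileAt P c).key g) x m = {c ∈ lam.cells | content c = m} := by
    refine filter_congr fun c hc => and_iff_right ?_
    exact hx _ (mem_image_of_mem _ (hP.tileAt_mem hc).1)
  have h3 : ∀ m, keyCount (P.image (Domino.key g)) x m =
      #{z ∈ P.image (Domino.key g) | z.diag = m} := by
    intro m
    rw [keyCount]
    congr 1
    exact filter_congr fun z hz => and_iff_right (hx z hz)
  rw [diagLength, ← h2, h1, h3, h3]

/-- A domino tableau is determined by the set of its keys. -/
theorem IsDominoFilling.eq_of_image_key_eq (hP : IsPaving lam P) (hg : IsDominoFilling P g)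
    {P' : Finset Domino} {g' : Domino → ℕ} (hP' : IsPaving lam P') (hg' : IsDominoFilling P' g')
    (h : P.image (Domino.key g) = P'.image (Domino.key g')) {d : Domino} (hd : d ∈ P) :
    d ∈ P' ∧ d.key g' = d.key g := by
  have hkey : ∀ c ∈ lam, (tileAt P c).key g = (tileAt P' c).key g' := fun c hc =>
    (hg.cellMonotone hP).eq_of_card (hg'.cellMonotone hP')
      (fun x m => by rw [hg.card_levelCells hP, hg'.card_levelCells hP', h]) hc
  have hd' : d.key g ∈ P'.image (Domino.key g') := h ▸ mem_image_of_mem _ hd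
  obtain ⟨e, he, hde⟩ := mem_image.1 hd'
  have hsub : d.boxes ⊆ e.boxes := by
    intro c hc
    have hcl := hP.mem_of_mem_boxes hd hc
    have h1 := hkey c hcl
    rw [hP.tileAt_eq hd hc, ← hde] at h1
    obtain ⟨h2, h3⟩ := hP'.tileAt_mem hcl
    rwa [hg'.key_injOn hP' he h2 h1]
  obtain rfl := Domino.eq_of_boxes_subset hsub
  exact ⟨he, hde⟩

end Paving

/-- Every interlacing set of keys of the right size is the set of keys of a domino tableau.  On
`D_m` the keys with diagonal `m` or `m + 1` are placed in increasing order; interlacing makes the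
two places of each key adjacent. -/
theorem exists_dominoFilling {lam : YoungDiagram} {K : Finset Key} (hK : Interlaced K)
    (hcard : ∀ m, diagLength lam m = #{z ∈ K | z.diag = m} + #{z ∈ K | z.diag = m + 1}) :
    ∃ (P : Finset Domino) (g : Domino → ℕ), IsPaving lam P ∧ IsDominoFilling P g ∧
      P.image (Domino.key g) = K := by
  classical
  set A : ℤ → Finset Key := fun m => {z ∈ K | z.diag = m ∨ z.diag = m + 1} with hA
  have hAle : ∀ x m, #{z ∈ A m | z ≤ x} = keyCount K x m + keyCount K x (m + 1) := by
    intro x m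
    rw [hA, filter_filter, keyCount, keyCount, ← card_union_of_disjoint, ← filter_or]
    · congr 1
      exact filter_congr fun z _ => by tauto
    · refine disjoint_filter.2 fun d _ h h' => ?_
      omega
  have hAcard : ∀ m, #(A m) = diagLength lam m := by
    intro m
    rw [hcard]
    simp only [hA]
    rw [filter_or, card_union_of_disjoint]
    refine disjoint_filter.2 fun d _ h h' => ?_
    omega
  obtain ⟨key, hmono, hkey, huniq⟩ := exists_cellMonotone (lam := lam) (A := A)
    (fun x m => by
      have := hK x m
      simp only [hAle, add_assoc, one_add_one_eq_two]
      omega) hAcard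
  -- The domino of a key.
  have hdom : ∀ x : Key, ∃ d : Domino, x ∈ K → d.topDiag = x.diag ∧
      ∀ c ∈ d.boxes, c ∈ lam ∧ key c = x := by
    intro x
    by_cases hx : x ∈ K
    swap
    · exact ⟨⟨0, 0, true⟩, fun h => absurd h hx⟩
    have hx1 : x ∈ A (x.diag - 1) := mem_filter.2 ⟨hx, Or.inr (by ring)⟩
    have hx2 : x ∈ A x.diag := mem_filter.2 ⟨hx, Or.inl rfl⟩
    obtain ⟨c, ⟨hc, hcm, hcx⟩, -⟩ := huniq _ x hx1
    obtain ⟨c', ⟨hc', hcm', hcx'⟩, -⟩ := huniq _ x hx2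
    have r1 := (hkey c hc).2
    have r2 := (hkey c' hc').2
    have s1 := rank_add_one hx1
    have s2 := rank_add_one hx2
    rw [hcx, hcm] at r1
    rw [hcx', hcm'] at r2
    rw [r1, hAle] at s1
    rw [r2, hAle] at s2
    have := hK x (x.diag - 1)
    rw [show x.diag - 1 + 2 = x.diag + 1 by ring] at this
    rw [show x.diag - 1 + 1 = x.diag by ring] at s1
    obtain ⟨d, rfl, rfl⟩ := exists_domino (c := c) (c' := c') (by omega)
      (by rw [hcm]; omega) (by rw [hcm]; omega)
    refine ⟨d, fun _ => ⟨hcm', fun b hb => ?_⟩⟩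
    rcases Domino.mem_boxes.1 hb with rfl | rfl
    · exact ⟨hc, hcx⟩
    · exact ⟨hc', hcx'⟩
  choose dom hdom using hdom
  have hkeyK : ∀ c ∈ lam, key c ∈ K := fun c hc => (mem_filter.1 (hkey c hc).1).1
  have hinK : ∀ d ∈ K.image dom, key d.upperBox ∈ K ∧ dom (key d.upperBox) = d := by
    intro d hd
    obtain ⟨x, hx, rfl⟩ := mem_image.1 hd
    rw [((hdom x hx).2 _ (Domino.mem_boxes.2 (Or.inr rfl))).2]
    exact ⟨hx, rfl⟩
  have hmem : ∀ d ∈ K.image dom, ∀ c ∈ d.boxes, c ∈ lam ∧ key c = key d.upperBox := by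
    intro d hd c hc
    obtain ⟨h1, h2⟩ := hinK d hd
    rw [← h2] at hc
    exact (hdom _ h1).2 c hc
  have hdiag : ∀ d ∈ K.image dom, (key d.upperBox).diag = d.topDiag := by
    intro d hd
    obtain ⟨h1, h2⟩ := hinK d hd
    rw [← (hdom _ h1).1, h2]
  refine ⟨K.image dom, fun d => (key d.upperBox).val, ⟨?_, ?_⟩, ⟨?_, ?_⟩, ?_⟩
  · intro d hd c hc
    exact (hmem d hd c hc).1
  · intro c hc
    have hx := hkeyK c hc
    refine ⟨dom (key c), ⟨mem_image_of_mem _ hx, ?_⟩, ?_⟩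
    · -- The box of `dom (key c)` on the diagonal of `c` has the same key as `c`.
      have hd := hdom _ hx
      have hmd := (mem_filter.1 (hkey c hc).1).2
      have : ∃ b ∈ (dom (key c)).boxes, content b = content c := by
        rcases hmd with h | h
        · exact ⟨_, Domino.mem_boxes.2 (Or.inr rfl), hd.1.trans h⟩
        · exact ⟨_, Domino.mem_boxes.2 (Or.inl rfl), by
            rw [Domino.content_lowerBox, hd.1, h]; ring⟩
      obtain ⟨b, hb, hbc⟩ := this
      have hbc' := (huniq _ _ (hkey c hc).1).unique ⟨(hd.2 b hb).1, hbc, (hd.2 b hb).2⟩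
        ⟨hc, rfl, rfl⟩
      rwa [hbc'] at hb
    · rintro e ⟨he, hce⟩
      rw [(hmem e he c hce).2, (hinK e he).2]
  · intro d hd e he i j j' hc hc' h
    have := hmono _ _ (Prod.mk_le_mk.2 ⟨le_rfl, h.le⟩) (hmem e he _ hc').1
    rw [(hmem d hd _ hc).2, (hmem e he _ hc').2, Key.le_iff] at this
    exact this.elim le_of_lt fun h => h.1.le
  · intro d hd e he i i' j hc hc' h hne
    have h1 := hmono _ _ (Prod.mk_le_mk.2 ⟨h.le, le_rfl⟩) (hmem e he _ hc').1
    rw [(hmem d hd _ hc).2, (hmem e he _ hc').2] at h1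
    have h2 : key d.upperBox ≠ key e.upperBox := fun h => hne <| by
      rw [← (hinK d hd).2, h, (hinK e he).2]
    have h3 := hdiag d hd
    have h4 := hdiag e he
    have h5 := Domino.content_of_mem hc
    have h6 := Domino.content_of_mem hc'
    rw [Key.le_iff] at h1
    simp only [content] at h5 h6
    by_contra! hcon
    refine h2 ?_
    rw [← mkKey_val_diag (key d.upperBox), ← mkKey_val_diag (key e.upperBox), mkKey_inj]
    omega
  · ext x
    constructor
    · intro hx
      obtain ⟨d, hd, rfl⟩ := mem_image.1 hx
      rw [Domino.key, ← hdiag d hd, mkKey_val_diag]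
      exact (hinK d hd).1
    · intro hx
      refine mem_image.2 ⟨dom x, mem_image_of_mem _ hx, ?_⟩
      have hk := ((hdom x hx).2 _ (Domino.mem_boxes.2 (Or.inr rfl))).2
      simp only [Domino.key]
      rw [hk, (hdom x hx).1, mkKey_val_diag]

/-! ### Semistandard fillings as sets of keys -/

/-- The filling `u` of `sig` weakly increases along rows and strictly increases down columns. -/
def IsSemistandardFilling (sig : YoungDiagram) (u : ℕ → ℕ → ℕ) : Prop :=
  (∀ i j₁ j₂ : ℕ, j₁ < j₂ → (i, j₂) ∈ sig → u i j₁ ≤ u i j₂) ∧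
    ∀ i₁ i₂ j : ℕ, i₁ < i₂ → (i₂, j) ∈ sig → u i₁ j < u i₂ j

/-- The key of a box of a component of the quotient: the box on `D_k` corresponds to a domino on
the diagonals `2k - 1 + r` and `2k + r`, where `r` is `0` for type `1` and `1` for type `2`. -/
def cellKey (u : ℕ → ℕ → ℕ) (r : ℤ) (c : ℕ × ℕ) : Key := mkKey (u c.1 c.2) (2 * content c + r)

section Semistandard

variable {sig : YoungDiagram} {u : ℕ → ℕ → ℕ}

theorem IsSemistandardFilling.le_of_row (h : IsSemistandardFilling sig u) {i j j' : ℕ}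
    (hj : j ≤ j') (hc : (i, j') ∈ sig) : u i j ≤ u i j' := by
  rcases hj.lt_or_eq with hj | rfl
  · exact h.1 i j j' hj hc
  · exact le_rfl

theorem IsSemistandardFilling.le_of_col (h : IsSemistandardFilling sig u) {i i' j : ℕ}
    (hi : i ≤ i') (hc : (i', j) ∈ sig) : u i j ≤ u i' j := by
  rcases hi.lt_or_eq with hi | rfl
  · exact (h.2 i i' j hi hc).le
  · exact le_rfl

theorem IsSemistandardFilling.le_of_le (h : IsSemistandardFilling sig u) {c c' : ℕ × ℕ}
    (hcc' : c ≤ c') (hc' : c' ∈ sig) : u c.1 c.2 ≤ u c'.1 c'.2 :=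
  (h.le_of_row hcc'.2 (sig.isLowerSet (Prod.mk_le_mk.2 ⟨hcc'.1, le_rfl⟩) hc')).trans
    (h.le_of_col hcc'.1 hc')

theorem IsSemistandardFilling.lt_of_le (h : IsSemistandardFilling sig u) {c c' : ℕ × ℕ}
    (hcc' : c ≤ c') (hlt : c.1 < c'.1) (hc' : c' ∈ sig) : u c.1 c.2 < u c'.1 c'.2 :=
  (h.le_of_row hcc'.2 (sig.isLowerSet (Prod.mk_le_mk.2 ⟨hcc'.1, le_rfl⟩) hc')).trans_lt
    (h.2 _ _ _ hlt hc')

theorem IsSemistandardFilling.cellMonotone (h : IsSemistandardFilling sig u) (r : ℤ) :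
    CellMonotone sig (cellKey u r) := by
  intro c c' hcc' hc'
  have h1 := h.le_of_le hcc' hc'
  have h2 := fun hlt => h.lt_of_le hcc' hlt hc'
  rw [cellKey, cellKey, mkKey_le_iff]
  have h3 := hcc'.1
  have h4 := hcc'.2
  simp only [content]
  omega

theorem IsSemistandardFilling.lt_of_diagIndex_lt (h : IsSemistandardFilling sig u) {c c' : ℕ × ℕ}
    (hcont : content c = content c') (hlt : diagIndex c < diagIndex c') (hc' : c' ∈ sig) :
    u c.1 c.2 < u c'.1 c'.2 := by
  refine h.lt_of_le ((le_iff_diagIndex_le hcont).2 hlt.le) ?_ hc'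
  simp only [content, diagIndex] at *
  omega

theorem IsSemistandardFilling.cellKey_injOn (h : IsSemistandardFilling sig u) (r : ℤ)
    {c c' : ℕ × ℕ} (hc : c ∈ sig) (hc' : c' ∈ sig) (hcc' : cellKey u r c = cellKey u r c') :
    c = c' := by
  obtain ⟨hv, hm⟩ := mkKey_inj.1 hcc'
  have hm : content c = content c' := by omega
  rcases lt_trichotomy (diagIndex c) (diagIndex c') with hlt | heq | hlt
  · exact absurd hv (h.lt_of_diagIndex_lt hm hlt hc').ne
  · exact eq_of_content_eq_of_diagIndex_eq hm heq
  · exact absurd hv (h.lt_of_diagIndex_lt hm.symm hlt hc).ne'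

/-- The keys of a filling of the component `sig`. -/
def cellKeys (sig : YoungDiagram) (u : ℕ → ℕ → ℕ) (r : ℤ) : Finset Key :=
  sig.cells.image (cellKey u r)

theorem mem_cellKeys {r : ℤ} {x : Key} : x ∈ cellKeys sig u r ↔ ∃ c ∈ sig, cellKey u r c = x := by
  simp [cellKeys]

theorem IsSemistandardFilling.keyCount_cellKeys (h : IsSemistandardFilling sig u) (r : ℤ)
    (x : Key) (k : ℤ) :
    keyCount (cellKeys sig u r) x (2 * k + r) = #(levelCells sig (cellKey u r) x k) := by
  rw [keyCount, cellKeys, filter_image, card_image_of_injOn, levelCells]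
  · congr 1
    refine filter_congr fun c _ => and_congr_right fun _ => ?_
    simp only [cellKey, diag_mkKey]
    omega
  · intro c hc c' hc' hcc'
    simp only [coe_filter, Set.mem_ofPred_eq] at hc hc'
    exact h.cellKey_injOn r hc.1 hc'.1 hcc'

theorem keyCount_cellKeys_of_ne {r : ℤ} {m : ℤ} (hm : ∀ k, m ≠ 2 * k + r) (x : Key) :
    keyCount (cellKeys sig u r) x m = 0 := by
  rw [keyCount, card_eq_zero, filter_eq_empty_iff]
  rintro z hz ⟨-, h⟩
  obtain ⟨c, -, rfl⟩ := mem_cellKeys.1 hz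
  exact hm (content c) h.symm

theorem keyCount_union {K K' : Finset Key} (h : Disjoint K K') (x : Key) (m : ℤ) :
    keyCount (K ∪ K') x m = keyCount K x m + keyCount K' x m := by
  rw [keyCount, filter_union, card_union_of_disjoint (disjoint_filter_filter h)]
  rfl

theorem disjoint_cellKeys (sig₁ sig₂ : YoungDiagram) (u₁ u₂ : ℕ → ℕ → ℕ) :
    Disjoint (cellKeys sig₁ u₁ 0) (cellKeys sig₂ u₂ 1) := by
  refine disjoint_left.2 fun x hx hx' => ?_
  obtain ⟨c, -, rfl⟩ := mem_cellKeys.1 hx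
  obtain ⟨c', -, h⟩ := mem_cellKeys.1 hx'
  have := (mkKey_inj.1 h).2
  omega

theorem IsSemistandardFilling.keyCount_even {sig₁ sig₂ : YoungDiagram} {u₁ u₂ : ℕ → ℕ → ℕ}
    (h : IsSemistandardFilling sig₁ u₁) (x : Key) (k : ℤ) :
    keyCount (cellKeys sig₁ u₁ 0 ∪ cellKeys sig₂ u₂ 1) x (2 * k) =
      #(levelCells sig₁ (cellKey u₁ 0) x k) := by
  rw [keyCount_union (disjoint_cellKeys _ _ _ _),
    keyCount_cellKeys_of_ne (r := 1) (fun k' => by omega), ← h.keyCount_cellKeys 0 x k, add_zero,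
    add_zero]

theorem IsSemistandardFilling.keyCount_odd {sig₁ sig₂ : YoungDiagram} {u₁ u₂ : ℕ → ℕ → ℕ}
    (h : IsSemistandardFilling sig₂ u₂) (x : Key) (k : ℤ) :
    keyCount (cellKeys sig₁ u₁ 0 ∪ cellKeys sig₂ u₂ 1) x (2 * k + 1) =
      #(levelCells sig₂ (cellKey u₂ 1) x k) := by
  rw [keyCount_union (disjoint_cellKeys _ _ _ _),
    keyCount_cellKeys_of_ne (r := 0) (fun k' => by omega), ← h.keyCount_cellKeys 1 x k, zero_add]

theorem negStep_two_mul_add {r : ℤ} (h0 : 0 ≤ r) (h1 : r ≤ 1) (k : ℤ) :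
    negStep (2 * k + r) = negStep k := by
  have := negStep_cases (2 * k + r)
  have := negStep_cases k
  omega

theorem interlaced_cellKeys {sig₁ sig₂ : YoungDiagram} {u₁ u₂ : ℕ → ℕ → ℕ}
    (h₁ : IsSemistandardFilling sig₁ u₁) (h₂ : IsSemistandardFilling sig₂ u₂) :
    Interlaced (cellKeys sig₁ u₁ 0 ∪ cellKeys sig₂ u₂ 1) := by
  intro x m
  obtain ⟨k, rfl | rfl⟩ := Int.even_or_odd' m
  · rw [show 2 * k + 2 = 2 * (k + 1) by ring, h₁.keyCount_even, h₁.keyCount_even]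
    have := negStep_two_mul_add le_rfl zero_le_one k
    rw [add_zero] at this
    rw [this]
    exact (h₁.cellMonotone 0).diagSteps x k
  · rw [show 2 * k + 1 + 2 = 2 * (k + 1) + 1 by ring, h₂.keyCount_odd, h₂.keyCount_odd,
      negStep_two_mul_add zero_le_one le_rfl k]
    exact (h₂.cellMonotone 1).diagSteps x k

/-- The keys of an interlacing set on the diagonals of one parity form a semistandard filling. -/
theorem exists_semistandardFilling {K : Finset Key} (hK : Interlaced K) {r : ℤ} (h0 : 0 ≤ r)
    (h1 : r ≤ 1) (hcard : ∀ k, #{z ∈ K | z.diag = 2 * k + r} = diagLength sig k) :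
    ∃ u, IsSemistandardFilling sig u ∧
      ∀ x, x ∈ cellKeys sig u r ↔ x ∈ K ∧ ∃ k, x.diag = 2 * k + r := by
  obtain ⟨key, hmono, hkey, huniq⟩ := exists_cellMonotone (lam := sig)
    (A := fun k => {z ∈ K | z.diag = 2 * k + r}) (fun x k => by
      have hc : ∀ k, #{z ∈ ({z ∈ K | z.diag = 2 * k + r} : Finset Key) | z ≤ x} =
          keyCount K x (2 * k + r) := fun k => by
        rw [filter_filter, keyCount]
        congr 1
        exact filter_congr fun z _ => and_comm
      simp only [hc]
      rw [← negStep_two_mul_add h0 h1, show 2 * (k + 1) + r = 2 * k + r + 2 by ring]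
      exact hK x _) hcard
  have hdiag : ∀ c ∈ sig, key c ∈ K ∧ (key c).diag = 2 * content c + r := fun c hc => by
    simpa using (hkey c hc).1
  have hcell : ∀ c ∈ sig, cellKey (fun i j => (key (i, j)).val) r c = key c := fun c hc => by
    rw [cellKey, ← (hdiag c hc).2, mkKey_val_diag]
  refine ⟨fun i j => (key (i, j)).val, ⟨fun i j j' hj hc => ?_, fun i i' j hi hc => ?_⟩,
    fun x => ?_⟩
  · have := hmono (i, j) (i, j') (Prod.mk_le_mk.2 ⟨le_rfl, hj.le⟩) hc
    rw [Key.le_iff] at this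
    exact this.elim le_of_lt fun h => h.1.le
  · have h2 : (i, j) ≤ (i', j) := Prod.mk_le_mk.2 ⟨hi.le, le_rfl⟩
    have h3 := hmono (i, j) (i', j) h2 hc
    rw [Key.le_iff, (hdiag _ hc).2, (hdiag _ (sig.isLowerSet h2 hc)).2] at h3
    simp only [content] at h3
    show (key (i, j)).val < (key (i', j)).val
    omega
  · rw [mem_cellKeys]
    constructor
    · rintro ⟨c, hc, rfl⟩
      rw [hcell c hc]
      exact ⟨(hdiag c hc).1, _, (hdiag c hc).2⟩
    · rintro ⟨hx, k, hk⟩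
      obtain ⟨c, ⟨hc, -, h⟩, -⟩ := huniq k x (mem_filter.2 ⟨hx, hk⟩)
      exact ⟨c, hc, (hcell c hc).trans h⟩

end Semistandard

/-! ### Diagonal words -/

/-- The diagonal lengths of `lam` are those of a diagram with empty 2-core and 2-quotient
`(sig₁, sig₂)`, where `sig₁` counts dominoes of type `1` and `sig₂` dominoes of type `2`. -/
def HasTwoQuotient (lam sig₁ sig₂ : YoungDiagram) : Prop :=
  ∀ k, diagLength lam (2 * k) = diagLength sig₁ k + diagLength sig₂ k ∧
    diagLength lam (2 * k + 1) = diagLength sig₂ k + diagLength sig₁ (k + 1)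

theorem exists_lower_bound_card (K : Finset Key) :
    ∃ M : ℤ, ∀ m < M, #{z ∈ K | z.diag = m} = 0 := by
  obtain ⟨M, hM⟩ := (K.image Key.diag).bddBelow
  refine ⟨M, fun m hm => ?_⟩
  rw [card_eq_zero, filter_eq_empty_iff]
  rintro z hz rfl
  exact hm.not_ge (hM (mem_coe.2 (mem_image_of_mem _ hz)))

theorem exists_lower_bound_diagLength (lam : YoungDiagram) :
    ∃ M : ℤ, ∀ m < M, diagLength lam m = 0 := by
  obtain ⟨M, hM⟩ := (lam.cells.image content).bddBelow
  refine ⟨M, fun m hm => ?_⟩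
  rw [diagLength, card_eq_zero, filter_eq_empty_iff]
  rintro c hc rfl
  exact hm.not_ge (hM (mem_coe.2 (mem_image_of_mem _ hc)))

/-- Sequences that vanish far to the left are equal if their increments are. -/
theorem eq_of_increments_eq {f g : ℤ → ℤ} {M : ℤ} (hf : ∀ m < M, f m = 0) (hg : ∀ m < M, g m = 0)
    (h : ∀ m, f (m + 1) - f m = g (m + 1) - g m) (m : ℤ) : f m = g m := by
  rcases lt_or_ge m M with hm | hm
  · rw [hf m hm, hg m hm]
  · have h0 : f (M - 1) = g (M - 1) := by rw [hf _ (by omega), hg _ (by omega)]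
    refine Int.leInduction (m := M - 1) (motive := fun m _ => f m = g m) h0 (fun n _ ih => ?_) m
      (by omega)
    have := h n
    omega

/-- The numbers of dominoes of the two types on the lines `D_{2k}` depend on the shape only. -/
theorem HasTwoQuotient.card_eq {lam sig₁ sig₂ : YoungDiagram} (hq : HasTwoQuotient lam sig₁ sig₂)
    {K : Finset Key}
    (hK : ∀ m, diagLength lam m = #{z ∈ K | z.diag = m} + #{z ∈ K | z.diag = m + 1}) (k : ℤ) :
    #{z ∈ K | z.diag = 2 * k} = diagLength sig₁ k ∧
      #{z ∈ K | z.diag = 2 * k + 1} = diagLength sig₂ k := by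
  obtain ⟨M₀, h0⟩ := exists_lower_bound_card K
  obtain ⟨M₁, h1⟩ := exists_lower_bound_diagLength sig₁
  obtain ⟨M₂, h2⟩ := exists_lower_bound_diagLength sig₂
  have hsum : ∀ k, #{z ∈ K | z.diag = 2 * k} + #{z ∈ K | z.diag = 2 * k + 1} =
      diagLength sig₁ k + diagLength sig₂ k := fun k => by rw [← hK, (hq k).1]
  have hsum' : ∀ k, #{z ∈ K | z.diag = 2 * k + 1} + #{z ∈ K | z.diag = 2 * (k + 1)} =
      diagLength sig₂ k + diagLength sig₁ (k + 1) := fun k => by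
    rw [← (hq k).2, hK, show 2 * k + 1 + 1 = 2 * (k + 1) by ring]
  have h : #{z ∈ K | z.diag = 2 * k} = diagLength sig₁ k := by
    have := eq_of_increments_eq (f := fun k => (#{z ∈ K | z.diag = 2 * k} : ℤ))
      (g := fun k => (diagLength sig₁ k : ℤ)) (M := min (min M₀ M₁) 0)
      (fun m hm => by
        have := h0 (2 * m) (by omega)
        omega)
      (fun m hm => by
        have := h1 m (by omega)
        omega)
      (fun m => by
        have := hsum m
        have := hsum' m
        omega) k
    exact_mod_cast this
  have := hsum k
  omega

/-- The dominoes of type `s` on `D_{2k}` are those with boxes on the diagonals `2k - 1 + r` and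
`2k + r`. -/
def IsTypeOffset (s : ℕ) (r : ℤ) : Prop := s = 1 ∧ r = 0 ∨ s = 2 ∧ r = 1

theorem IsTypeOffset.onDiag_and_type_iff {s : ℕ} {r : ℤ} (h : IsTypeOffset s r) {d : Domino}
    {k : ℤ} : d.OnDiag k ∧ d.type = s ↔ d.topDiag = 2 * k + r := by
  rw [Domino.onDiag_iff, Domino.type_eq]
  rcases h with ⟨rfl, rfl⟩ | ⟨rfl, rfl⟩ <;> split_ifs with hd
  all_goals
    simp only [Int.even_iff] at hd
    omega

section Words

variable {α : Type*} {val : α → ℕ}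

/-- The word of the entries of the dominoes of type `s` on `D_{2k}`. -/
noncomputable def tileWord (lam : YoungDiagram) (P : Finset Domino) (f : Domino → α) (s : ℕ)
    (k : ℤ) : List α :=
  ((dominoesOnDiag lam P k).filter fun d => d.type = s).map f

/-- The word of the entries of the boxes on `D_k`. -/
def cellWord (sig : YoungDiagram) (t : ℕ → ℕ → α) (k : ℤ) : List α :=
  (diagBoxes sig k).map fun c => t c.1 c.2

theorem IsPaving.dominoesOnDiag_eq {lam : YoungDiagram} {P : Finset Domino} (hP : IsPaving lam P)
    (k : ℤ) : dominoesOnDiag lam P k = (diagBoxes lam (2 * k)).map (tileAt P) := by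
  rw [dominoesOnDiag, ← List.flatMap_pure_eq_map]
  refine List.flatMap_congr fun c hc => ?_
  obtain ⟨h1, h2⟩ := hP.tileAt_mem (mem_diagBoxes.1 hc).1
  have : ({d ∈ P | c ∈ d.boxes} : Finset Domino) = {tileAt P c} := by
    ext d
    rw [mem_filter, mem_singleton]
    constructor
    · rintro ⟨hd, hc⟩
      exact (hP.tileAt_eq hd hc).symm
    · rintro rfl
      exact ⟨h1, h2⟩
  rw [this, toList_singleton]
  rfl

theorem IsPaving.mem_tileWord {lam : YoungDiagram} {P : Finset Domino} (hP : IsPaving lam P)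
    {f : Domino → α} {s : ℕ} {r : ℤ} (hs : IsTypeOffset s r) {k : ℤ} {a : α} :
    a ∈ tileWord lam P f s k ↔ ∃ d ∈ P, d.topDiag = 2 * k + r ∧ f d = a := by
  simp only [tileWord, hP.dominoesOnDiag_eq, List.mem_map, List.mem_filter, mem_diagBoxes,
    decide_eq_true_eq]
  constructor
  · rintro ⟨_, ⟨⟨c, ⟨hc, hk⟩, rfl⟩, ht⟩, rfl⟩
    obtain ⟨h1, h2⟩ := hP.tileAt_mem hc
    exact ⟨_, h1, hs.onDiag_and_type_iff.1 ⟨⟨c, h2, hk⟩, ht⟩, rfl⟩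
  · rintro ⟨d, hd, ht, rfl⟩
    obtain ⟨⟨c, hc, hk⟩, ht⟩ := hs.onDiag_and_type_iff.2 ht
    exact ⟨d, ⟨⟨c, ⟨hP.mem_of_mem_boxes hd hc, hk⟩, hP.tileAt_eq hd hc⟩, ht⟩, rfl⟩

theorem mem_cellWord {sig : YoungDiagram} {t : ℕ → ℕ → α} {k : ℤ} {a : α} :
    a ∈ cellWord sig t k ↔ ∃ c ∈ sig, content c = k ∧ t c.1 c.2 = a := by
  simp [cellWord, mem_diagBoxes, and_assoc]

theorem IsDominoFilling.tileWord_pairwise {lam : YoungDiagram} {P : Finset Domino}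
    {f : Domino → α} (hP : IsPaving lam P) (hf : IsDominoFilling P fun d => val (f d))
    {s : ℕ} {r : ℤ} (hs : IsTypeOffset s r) (k : ℤ) :
    (tileWord lam P f s k).Pairwise fun a b => val a < val b := by
  rw [tileWord, List.pairwise_map, List.pairwise_filter, hP.dominoesOnDiag_eq, List.pairwise_map]
  refine (diagBoxes_pairwise lam (2 * k)).imp_of_mem fun {c c'} hc hc' hlt ht ht' => ?_
  obtain ⟨hc, hk⟩ := mem_diagBoxes.1 hc
  obtain ⟨hc', hk'⟩ := mem_diagBoxes.1 hc'
  obtain ⟨h1, h2⟩ := hP.tileAt_mem hc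
  obtain ⟨h1', h2'⟩ := hP.tileAt_mem hc'
  refine hf.lt_of_diagIndex_lt hP h1 h1' ?_ h2 h2' (hk.trans hk'.symm) hlt
  rw [hs.onDiag_and_type_iff.1 ⟨⟨c, h2, hk⟩, of_decide_eq_true ht⟩,
    hs.onDiag_and_type_iff.1 ⟨⟨c', h2', hk'⟩, of_decide_eq_true ht'⟩]

theorem IsSemistandardFilling.cellWord_pairwise {sig : YoungDiagram} {t : ℕ → ℕ → α}
    (ht : IsSemistandardFilling sig fun i j => val (t i j)) (k : ℤ) :
    (cellWord sig t k).Pairwise fun a b => val a < val b := by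
  rw [cellWord, List.pairwise_map]
  refine (diagBoxes_pairwise sig k).imp_of_mem fun {c c'} hc hc' hlt => ?_
  obtain ⟨hc, hk⟩ := mem_diagBoxes.1 hc
  obtain ⟨hc', hk'⟩ := mem_diagBoxes.1 hc'
  exact ht.lt_of_diagIndex_lt (hk.trans hk'.symm) hlt hc'

theorem List.eq_of_pairwise_lt_of_mem_iff {l l' : List α}
    (h : l.Pairwise fun a b => val a < val b) (h' : l'.Pairwise fun a b => val a < val b)
    (hmem : ∀ a, a ∈ l ↔ a ∈ l') : l = l' := by
  have hn : l.Nodup := h.imp fun {a b} hab => by rintro rfl; exact hab.false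
  have hn' : l'.Nodup := h'.imp fun {a b} hab => by rintro rfl; exact hab.false
  exact ((List.perm_ext_iff_of_nodup hn hn').2 hmem).eq_of_pairwise
    (fun a b _ _ h1 h2 => absurd h1 h2.asymm) h h'

/-- Both words strictly increase, so that they agree as soon as they have the same letters. -/
theorem cellWord_eq_tileWord_iff {lam sig : YoungDiagram} {P : Finset Domino} {f : Domino → α}
    {t : ℕ → ℕ → α} (hP : IsPaving lam P) (hf : IsDominoFilling P fun d => val (f d))
    (ht : IsSemistandardFilling sig fun i j => val (t i j)) {s : ℕ} {r : ℤ}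
    (hs : IsTypeOffset s r) {k : ℤ} :
    cellWord sig t k = tileWord lam P f s k ↔
      ∀ a, (∃ c ∈ sig, content c = k ∧ t c.1 c.2 = a) ↔
        ∃ d ∈ P, d.topDiag = 2 * k + r ∧ f d = a := by
  simp only [← mem_cellWord, ← hP.mem_tileWord hs]
  constructor
  · intro h a
    rw [h]
  · exact List.eq_of_pairwise_lt_of_mem_iff (ht.cellWord_pairwise k) (hf.tileWord_pairwise hP hs k)

theorem eq_of_cellWord_eq {sig : YoungDiagram} {t t' : ℕ → ℕ → α}
    (h : ∀ k, cellWord sig t k = cellWord sig t' k) {c : ℕ × ℕ} (hc : c ∈ sig) :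
    t c.1 c.2 = t' c.1 c.2 :=
  List.map_inj_left.1 (h (content c)) c (mem_diagBoxes.2 ⟨hc, rfl⟩)

/-- From a domino tableau with labels in `α`, ordered by `val`, to a component of the corresponding
pair.  The labels outside `sig` are set to `z`. -/
theorem exists_cellFilling {lam sig : YoungDiagram} {P : Finset Domino} {f : Domino → α}
    (hP : IsPaving lam P) (hf : IsDominoFilling P fun d => val (f d)) {s : ℕ} {r : ℤ}
    (hs : IsTypeOffset s r)
    (hcard : ∀ k, #{z ∈ P.image (Domino.key fun d => val (f d)) | z.diag = 2 * k + r} =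
      diagLength sig k) (z : α) :
    ∃ t : ℕ → ℕ → α, IsSemistandardFilling sig (fun i j => val (t i j)) ∧
      (∀ k, cellWord sig t k = tileWord lam P f s k) ∧ ∀ i j, (i, j) ∉ sig → t i j = z := by
  obtain ⟨u, hu, hkey⟩ := exists_semistandardFilling (sig := sig) (hf.interlaced hP) (r := r)
    (by rcases hs with ⟨-, rfl⟩ | ⟨-, rfl⟩ <;> norm_num)
    (by rcases hs with ⟨-, rfl⟩ | ⟨-, rfl⟩ <;> norm_num) hcard
  have hlab : ∀ i j, ∃ a, ((i, j) ∈ sig → ∃ d ∈ P,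
      d.key (fun d => val (f d)) = cellKey u r (i, j) ∧ f d = a) ∧ ((i, j) ∉ sig → a = z) := by
    intro i j
    by_cases hij : (i, j) ∈ sig
    · obtain ⟨d, hd, h⟩ := mem_image.1 ((hkey _).1 (mem_cellKeys.2 ⟨_, hij, rfl⟩)).1
      exact ⟨f d, fun _ => ⟨d, hd, h, rfl⟩, fun h => absurd hij h⟩
    · exact ⟨z, fun h => absurd h hij, fun _ => rfl⟩
  choose t ht ht' using hlab
  have hval : ∀ i j, (i, j) ∈ sig → val (t i j) = u i j := by
    intro i j hij
    obtain ⟨d, hd, h, h'⟩ := ht i j hij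
    rw [← h']
    exact (mkKey_inj.1 h).1
  have htu : IsSemistandardFilling sig (fun i j => val (t i j)) := by
    refine ⟨fun i j j' hj hc => ?_, fun i i' j hi hc => ?_⟩
    · beta_reduce
      rw [hval _ _ hc, hval _ _ (sig.isLowerSet (Prod.mk_le_mk.2 ⟨le_rfl, hj.le⟩) hc)]
      exact hu.1 i j j' hj hc
    · beta_reduce
      rw [hval _ _ hc, hval _ _ (sig.isLowerSet (Prod.mk_le_mk.2 ⟨hi.le, le_rfl⟩) hc)]
      exact hu.2 i i' j hi hc
  refine ⟨t, htu, fun k => (cellWord_eq_tileWord_iff hP hf htu hs).2 fun a => ?_, ht'⟩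
  constructor
  · rintro ⟨⟨i, j⟩, hc, rfl, rfl⟩
    obtain ⟨d, hd, h, h'⟩ := ht i j hc
    exact ⟨d, hd, (mkKey_inj.1 h).2, h'⟩
  · rintro ⟨d, hd, hk, rfl⟩
    obtain ⟨c, hc, h⟩ := mem_cellKeys.1 ((hkey _).2 ⟨mem_image_of_mem _ hd, k, hk⟩)
    obtain ⟨e, he, h1, h2⟩ := ht _ _ hc
    rw [← hf.key_injOn hP he hd (h1.trans h)]
    refine ⟨c, hc, ?_, h2.symm⟩
    have := (mkKey_inj.1 h).2
    omega

/-- A labelled domino tableau is determined by its words. -/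
theorem IsDominoFilling.eq_of_tileWord_eq {lam : YoungDiagram} {P P' : Finset Domino}
    {f f' : Domino → α} (hP : IsPaving lam P) (hf : IsDominoFilling P fun d => val (f d))
    (hP' : IsPaving lam P') (hf' : IsDominoFilling P' fun d => val (f' d))
    (h₁ : ∀ k, tileWord lam P f 1 k = tileWord lam P' f' 1 k)
    (h₂ : ∀ k, tileWord lam P f 2 k = tileWord lam P' f' 2 k) :
    P = P' ∧ ∀ d ∈ P, f d = f' d := by
  have hmem : ∀ m a, (∃ d ∈ P, d.topDiag = m ∧ f d = a) ↔ ∃ d ∈ P', d.topDiag = m ∧ f' d = a := by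
    intro m a
    obtain ⟨k, hk | hk⟩ := Int.even_or_odd' m
    · have hs : IsTypeOffset 1 0 := Or.inl ⟨rfl, rfl⟩
      have h := hP.mem_tileWord hs (f := f) (k := k) (a := a)
      rw [h₁ k, hP'.mem_tileWord hs, add_zero, ← hk] at h
      exact h.symm
    · have hs : IsTypeOffset 2 1 := Or.inr ⟨rfl, rfl⟩
      have h := hP.mem_tileWord hs (f := f) (k := k) (a := a)
      rw [h₂ k, hP'.mem_tileWord hs, ← hk] at h
      exact h.symm
  have himg : P.image (Domino.key fun d => val (f d)) =
      P'.image (Domino.key fun d => val (f' d)) := by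
    ext x
    simp only [mem_image]
    constructor
    · rintro ⟨d, hd, rfl⟩
      obtain ⟨e, he, h1, h2⟩ := (hmem d.topDiag (f d)).1 ⟨d, hd, rfl, rfl⟩
      exact ⟨e, he, by simp only [Domino.key, h1, h2]⟩
    · rintro ⟨d, hd, rfl⟩
      obtain ⟨e, he, h1, h2⟩ := (hmem d.topDiag (f' d)).2 ⟨d, hd, rfl, rfl⟩
      exact ⟨e, he, by simp only [Domino.key, h1, h2]⟩
  refine ⟨?_, fun d hd => ?_⟩
  · ext d
    exact ⟨fun hd => (hf.eq_of_image_key_eq hP hP' hf' himg hd).1,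
      fun hd => (hf'.eq_of_image_key_eq hP' hP hf himg.symm hd).1⟩
  · obtain ⟨hd', hk⟩ := hf.eq_of_image_key_eq hP hP' hf' himg hd
    obtain ⟨e, he, h1, h2⟩ := (hmem d.topDiag (f d)).1 ⟨d, hd, rfl, rfl⟩
    have : e.key (fun d => val (f' d)) = d.key fun d => val (f' d) := by
      rw [hk]
      simp only [Domino.key, h1, h2]
    rw [← h2, hf'.key_injOn hP' he hd' this]

/-- From a pair of labelled tableaux to the corresponding domino tableau. -/
theorem exists_tileFilling {lam sig₁ sig₂ : YoungDiagram} (hq : HasTwoQuotient lam sig₁ sig₂)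
    {t₁ t₂ : ℕ → ℕ → α} (h₁ : IsSemistandardFilling sig₁ fun i j => val (t₁ i j))
    (h₂ : IsSemistandardFilling sig₂ fun i j => val (t₂ i j)) (z : α) :
    ∃ (P : Finset Domino) (f : Domino → α), IsPaving lam P ∧
      IsDominoFilling P (fun d => val (f d)) ∧
      (∀ k, cellWord sig₁ t₁ k = tileWord lam P f 1 k) ∧
      (∀ k, cellWord sig₂ t₂ k = tileWord lam P f 2 k) ∧ ∀ d ∉ P, f d = z := by
  set K := cellKeys sig₁ (fun i j => val (t₁ i j)) 0 ∪ cellKeys sig₂ (fun i j => val (t₂ i j)) 1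
    with hKdef
  have hlevel : ∀ (sig : YoungDiagram) (key : ℕ × ℕ → Key) (x : Key),
      (∀ c ∈ sig, key c ≤ x) → ∀ k, #(levelCells sig key x k) = diagLength sig k := by
    intro sig key x hx k
    rw [levelCells, diagLength]
    congr 1
    exact filter_congr fun c hc => and_iff_right (hx c hc)
  obtain ⟨x, hx⟩ := exists_key_bound K
  have htotal : ∀ m, #{z ∈ K | z.diag = m} = keyCount K x m := fun m => by
    rw [keyCount]
    congr 1
    exact filter_congr fun z hz => (and_iff_right (hx z hz)).symm
  have heven : ∀ k, #{z ∈ K | z.diag = 2 * k} = diagLength sig₁ k := fun k => by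
    rw [htotal, h₁.keyCount_even, hlevel _ _ _ fun c hc =>
      hx _ (mem_union_left _ (mem_cellKeys.2 ⟨c, hc, rfl⟩))]
  have hodd : ∀ k, #{z ∈ K | z.diag = 2 * k + 1} = diagLength sig₂ k := fun k => by
    rw [htotal, h₂.keyCount_odd, hlevel _ _ _ fun c hc =>
      hx _ (mem_union_right _ (mem_cellKeys.2 ⟨c, hc, rfl⟩))]
  obtain ⟨P, g, hP, hg, himg⟩ := exists_dominoFilling (lam := lam) (interlaced_cellKeys h₁ h₂)
    (fun m => by
      obtain ⟨k, rfl | rfl⟩ := Int.even_or_odd' m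
      · rw [(hq k).1, heven, hodd]
      · rw [(hq k).2, show 2 * k + 1 + 1 = 2 * (k + 1) by ring, heven, hodd])
  rw [← hKdef] at himg
  have hlab : ∀ d : Domino, ∃ a, (d ∈ P → ((∃ c ∈ sig₁, cellKey (fun i j => val (t₁ i j)) 0 c =
      d.key g ∧ t₁ c.1 c.2 = a) ∨ ∃ c ∈ sig₂, cellKey (fun i j => val (t₂ i j)) 1 c =
      d.key g ∧ t₂ c.1 c.2 = a)) ∧ (d ∉ P → a = z) := by
    intro d
    by_cases hd : d ∈ P
    · have : d.key g ∈ K := himg ▸ mem_image_of_mem _ hd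
      rcases mem_union.1 this with h | h
      · obtain ⟨c, hc, h⟩ := mem_cellKeys.1 h
        exact ⟨_, fun _ => Or.inl ⟨c, hc, h, rfl⟩, fun h => absurd hd h⟩
      · obtain ⟨c, hc, h⟩ := mem_cellKeys.1 h
        exact ⟨_, fun _ => Or.inr ⟨c, hc, h, rfl⟩, fun h => absurd hd h⟩
    · exact ⟨z, fun h => absurd h hd, fun _ => rfl⟩
  choose f hf hf' using hlab
  have hval : ∀ d ∈ P, val (f d) = g d := by
    intro d hd
    rcases hf d hd with ⟨c, -, h, h'⟩ | ⟨c, -, h, h'⟩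
    · rw [← h']
      exact (mkKey_inj.1 h).1
    · rw [← h']
      exact (mkKey_inj.1 h).1
  have hfg : IsDominoFilling P (fun d => val (f d)) := by
    refine ⟨fun d hd e he i j j' hc hc' h => ?_, fun d hd e he i i' j hc hc' h hne => ?_⟩
    · beta_reduce
      rw [hval d hd, hval e he]
      exact hg.1 d hd e he i j j' hc hc' h
    · beta_reduce
      rw [hval d hd, hval e he]
      exact hg.2 d hd e he i i' j hc hc' h hne
  refine ⟨P, f, hP, hfg, fun k => ?_, fun k => ?_, hf'⟩
  · refine (cellWord_eq_tileWord_iff hP hfg h₁ (Or.inl ⟨rfl, rfl⟩)).2 fun a => ?_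
    constructor
    · rintro ⟨c, hc, rfl, rfl⟩
      have : cellKey (fun i j => val (t₁ i j)) 0 c ∈ P.image (Domino.key g) :=
        himg ▸ mem_union_left _ (mem_cellKeys.2 ⟨c, hc, rfl⟩)
      obtain ⟨d, hd, h⟩ := mem_image.1 this
      refine ⟨d, hd, (mkKey_inj.1 h).2, ?_⟩
      rcases hf d hd with ⟨c', hc', h1, h2⟩ | ⟨c', hc', h1, h2⟩
      · rw [← h2, h₁.cellKey_injOn 0 hc' hc (h1.trans h)]
      · have := (mkKey_inj.1 (h1.trans h)).2
        omega
    · rintro ⟨d, hd, hk, rfl⟩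
      rcases hf d hd with ⟨c', hc', h1, h2⟩ | ⟨c', hc', h1, h2⟩
      · have := (mkKey_inj.1 h1).2
        exact ⟨c', hc', by omega, h2⟩
      · have := (mkKey_inj.1 h1).2
        omega
  · refine (cellWord_eq_tileWord_iff hP hfg h₂ (Or.inr ⟨rfl, rfl⟩)).2 fun a => ?_
    constructor
    · rintro ⟨c, hc, rfl, rfl⟩
      have : cellKey (fun i j => val (t₂ i j)) 1 c ∈ P.image (Domino.key g) :=
        himg ▸ mem_union_right _ (mem_cellKeys.2 ⟨c, hc, rfl⟩)
      obtain ⟨d, hd, h⟩ := mem_image.1 this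
      refine ⟨d, hd, (mkKey_inj.1 h).2, ?_⟩
      rcases hf d hd with ⟨c', hc', h1, h2⟩ | ⟨c', hc', h1, h2⟩
      · have := (mkKey_inj.1 (h1.trans h)).2
        omega
      · rw [← h2, h₂.cellKey_injOn 1 hc' hc (h1.trans h)]
    · rintro ⟨d, hd, hk, rfl⟩
      rcases hf d hd with ⟨c', hc', h1, h2⟩ | ⟨c', hc', h1, h2⟩
      · have := (mkKey_inj.1 h1).2
        omega
      · have := (mkKey_inj.1 h1).2
        exact ⟨c', hc', by omega, h2⟩

end Words

/-! ### Diagonal lengths of the 2-quotient -/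

/-- The content of the last box of row `i` (of the box to the left of the row, if it is empty). -/
def rowEnd (Y : YoungDiagram) (i : ℕ) : ℤ := Y.rowLen i - i - 1

theorem rowEnd_strictAnti (Y : YoungDiagram) : StrictAnti (rowEnd Y) := by
  intro i j hij
  have := Y.rowLen_anti i j hij.le
  simp only [rowEnd]
  omega

theorem neg_sub_one_strictAnti : StrictAnti fun i : ℕ => -(i : ℤ) - 1 := by
  intro i j hij
  simp only
  omega

theorem card_fiber_eq {f f' : ℕ → ℤ} (hf : StrictAnti f) (hf' : StrictAnti f') {q q' : ℕ}
    {v v' : ℤ} (h : (∃ i < q, f i = v) ↔ ∃ i < q', f' i = v') :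
    #{i ∈ range q | f i = v} = #{i ∈ range q' | f' i = v'} := by
  have hone : ∀ {f : ℕ → ℤ} (_ : StrictAnti f) {q : ℕ} {v : ℤ}, (∃ i < q, f i = v) →
      #{i ∈ range q | f i = v} = 1 := by
    rintro f hf q v ⟨i, hi, rfl⟩
    rw [card_eq_one]
    refine ⟨i, ?_⟩
    ext j
    simp only [mem_filter, mem_range, mem_singleton, hf.injective.eq_iff]
    exact ⟨fun h => h.2, fun h => ⟨h ▸ hi, h⟩⟩
  have hzero : ∀ {f : ℕ → ℤ} {q : ℕ} {v : ℤ}, (¬∃ i < q, f i = v) →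
      #{i ∈ range q | f i = v} = 0 := by
    intro f q v hn
    rw [card_eq_zero, filter_eq_empty_iff]
    intro i hi h
    exact hn ⟨i, mem_range.1 hi, h⟩
  by_cases h1 : ∃ i < q, f i = v
  · rw [hone hf h1, hone hf' (h.1 h1)]
  · rw [hzero h1, hzero (mt h.2 h1)]

theorem diagLength_eq_card_rows (Y : YoungDiagram) {q : ℕ} (hq : ∀ i, q ≤ i → Y.rowLen i = 0)
    (k : ℤ) : diagLength Y k = #{i ∈ range q | 0 ≤ k + ((i : ℕ) : ℤ) ∧ k + i < Y.rowLen i} := by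
  rw [diagLength]
  refine card_bij (fun c _ => c.1) ?_ ?_ ?_
  · rintro ⟨i, j⟩ hc
    obtain ⟨hmem, rfl⟩ := mem_filter.1 hc
    rw [YoungDiagram.mem_cells, YoungDiagram.mem_iff_lt_rowLen] at hmem
    have : i < q := by
      by_contra! h
      rw [hq i h] at hmem
      omega
    refine mem_filter.2 ⟨mem_range.2 this, ?_⟩
    simp only [content]
    omega
  · rintro ⟨i, j⟩ hc ⟨i', j'⟩ hc' h
    obtain ⟨-, h1⟩ := mem_filter.1 hc
    obtain ⟨-, h2⟩ := mem_filter.1 hc'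
    simp only [content] at h h1 h2
    simp only [Prod.mk.injEq]
    omega
  · intro i hi
    simp only [mem_filter, mem_range] at hi
    refine ⟨(i, (k + i).toNat), mem_filter.2 ⟨?_, ?_⟩, rfl⟩
    · rw [YoungDiagram.mem_cells, YoungDiagram.mem_iff_lt_rowLen]
      omega
    · simp only [content]
      omega

/-- A row meets `D_k` but not `D_{k+1}` if its last box is on `D_k`, and it meets `D_{k+1}` but not
`D_k` if its first box is on `D_{k+1}`.  For an empty row both conditions on the right hold for the
same `k` and cancel. -/
theorem diagLength_sub (Y : YoungDiagram) {q : ℕ} (hq : ∀ i, q ≤ i → Y.rowLen i = 0) (k : ℤ) :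
    (diagLength Y k : ℤ) - diagLength Y (k + 1) =
      #{i ∈ range q | rowEnd Y i = k} - #{i ∈ range q | -((i : ℕ) : ℤ) - 1 = k} := by
  rw [diagLength_eq_card_rows Y hq, diagLength_eq_card_rows Y hq]
  simp only [card_filter, Nat.cast_sum, ← sum_sub_distrib]
  refine sum_congr rfl fun i _ => ?_
  have : rowEnd Y i = Y.rowLen i - i - 1 := rfl
  split_ifs <;> simp <;> omega

theorem rowLen_eq_zero {lam : YoungDiagram} {i : ℕ} (hi : lam.rowLens.length ≤ i) :
    lam.rowLen i = 0 := by
  by_contra h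
  have : (i, 0) ∈ lam := YoungDiagram.mem_iff_lt_rowLen.2 (Nat.pos_of_ne_zero h)
  rw [YoungDiagram.mem_iff_lt_colLen, ← YoungDiagram.length_rowLens] at this
  omega

theorem mem_betaList {lam : YoungDiagram} {l : ℕ} :
    l ∈ betaList lam ↔ ∃ i < lam.rowLens.length, (l : ℤ) = rowEnd lam i + lam.rowLens.length := by
  simp only [betaList, List.mem_mapIdx, YoungDiagram.get_rowLens, rowEnd]
  constructor
  · rintro ⟨i, hi, rfl⟩
    exact ⟨i, hi, by omega⟩
  · rintro ⟨i, hi, h⟩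
    exact ⟨i, hi, by omega⟩

theorem mem_betaPart {lam : YoungDiagram} {a l : ℕ} :
    l ∈ betaPart lam a ↔ l ∈ betaList lam ∧ l % 2 = a := by
  simp [betaPart]

theorem betaPart_pairwise (lam : YoungDiagram) (a : ℕ) : (betaPart lam a).Pairwise (· > ·) :=
  (betaList_sortedGT lam).pairwise.filter _

/-- The components of one parity are at least as large as the subtracted numbers. -/
theorem le_getElem_of_pairwise_of_mod {a : ℕ} {B : List ℕ} (hB : B.Pairwise (· > ·))
    (hmod : ∀ x ∈ B, x % 2 = a) {j : ℕ} (hj : j < B.length) :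
    2 * (B.length - 1 - j) + a ≤ B[j] := by
  induction B generalizing j with
  | nil => simp at hj
  | cons x B ih =>
    rw [List.pairwise_cons] at hB
    have ih := fun j hj => ih hB.2 (fun y hy => hmod y (List.mem_cons_of_mem _ hy)) (j := j) hj
    have hx := hmod x List.mem_cons_self
    cases j with
    | zero =>
      simp only [List.getElem_cons_zero, List.length_cons]
      rcases Nat.eq_zero_or_pos B.length with h0 | hpos
      · omega
      · have h1 := ih 0 hpos
        have h2 := hB.1 _ (List.getElem_mem hpos)
        have h3 := hmod _ (List.mem_cons_of_mem x (List.getElem_mem hpos))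
        omega
    | succ j =>
      have := ih j (by simpa using hj)
      simp only [List.getElem_cons_succ, List.length_cons]
      omega

theorem getD_filter_ne_zero {Z : List ℕ} (hZ : Z.Pairwise (· ≥ ·)) (i : ℕ) :
    (Z.filter fun x => x ≠ 0).getD i 0 = Z.getD i 0 := by
  induction Z generalizing i with
  | nil => rfl
  | cons x Z ih =>
    rw [List.pairwise_cons] at hZ
    by_cases hx : x = 0
    · subst hx
      have h0 : ∀ y ∈ Z, y = 0 := fun y hy => Nat.le_zero.1 (hZ.1 y hy)
      have h1 : ((0 :: Z).filter fun x => x ≠ 0) = [] := by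
        simpa [List.filter_eq_nil_iff] using h0
      rw [h1]
      cases i with
      | zero => rfl
      | succ i =>
        rw [List.getD_cons_succ]
        rcases lt_or_ge i Z.length with h | h
        · rw [List.getD_eq_getElem _ _ h, h0 _ (List.getElem_mem h)]
          rfl
        · rw [List.getD_eq_default _ _ h]
          rfl
    · rw [List.filter_cons_of_pos (by simpa using hx)]
      cases i with
      | zero => rfl
      | succ i => simpa using ih hZ.2 i

theorem rowLen_ofRowLens_getD {w : List ℕ} {hw : w.SortedGE} (i : ℕ) :
    (YoungDiagram.ofRowLens w hw).rowLen i = w.getD i 0 := by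
  rcases lt_or_ge i w.length with h | h
  · rw [List.getD_eq_getElem _ _ h]
    exact YoungDiagram.rowLen_ofRowLens ⟨i, h⟩
  · rw [List.getD_eq_default _ _ h]
    by_contra hne
    have : (i, 0) ∈ YoungDiagram.ofRowLens w hw :=
      YoungDiagram.mem_iff_lt_rowLen.2 (Nat.pos_of_ne_zero hne)
    obtain ⟨h', -⟩ := YoungDiagram.mem_ofRowLens.1 this
    exact h.not_gt h'

/-- The component of the 2-quotient that comes from the numbers congruent to `a` in the list `L`. -/
def quotientComponent (lam : YoungDiagram) (a : ℕ) : YoungDiagram :=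
  YoungDiagram.ofRowLens (quotientParts lam a) (quotientParts_sortedGE lam a)

theorem quotient_zipWith_pairwise (lam : YoungDiagram) (a : ℕ) :
    (List.zipWith (fun l m => (l - m) / 2) (betaPart lam a) (replacedPart lam a)).Pairwise
      (· ≥ ·) := by
  rw [List.pairwise_iff_getElem]
  intro i j hi hj hij
  simp only [List.length_zipWith, replacedPart, List.length_reverse, List.length_map,
    List.length_range, min_self] at hi hj
  have hmod : ∀ x ∈ betaPart lam a, x % 2 = a := fun x hx => (mem_betaPart.1 hx).2
  have hb := betaPart_pairwise lam a
  have hlt : ∀ n m (hn : n < (betaPart lam a).length) (hm : m < (betaPart lam a).length),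
      n ≤ m → (betaPart lam a)[m] + 2 * (m - n) ≤ (betaPart lam a)[n] := by
    intro n m hn hm hnm
    induction m, hnm using Nat.le_induction with
    | base => simp
    | succ m hnm ih =>
      have h1 := ih (by omega)
      have h2 := (List.pairwise_iff_getElem.1 hb) m (m + 1) (by omega) hm (by omega)
      have h3 := hmod _ (List.getElem_mem hm)
      have h4 := hmod _ (List.getElem_mem (h := (by omega : m < (betaPart lam a).length)))
      omega
  have := hlt i j hi hj hij.le
  simp only [List.getElem_zipWith, replacedPart, List.getElem_reverse, List.getElem_map,
    List.getElem_range, List.length_map, List.length_range]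
  omega

theorem rowLen_quotientComponent {lam : YoungDiagram} {a : ℕ} {j : ℕ}
    (hj : j < (betaPart lam a).length) :
    2 * (quotientComponent lam a).rowLen j + 2 * ((betaPart lam a).length - 1 - j) + a =
      (betaPart lam a)[j] := by
  have h1 := le_getElem_of_pairwise_of_mod (betaPart_pairwise lam a)
    (fun x hx => (mem_betaPart.1 hx).2) hj
  have h2 := (mem_betaPart.1 (List.getElem_mem hj)).2
  rw [quotientComponent, rowLen_ofRowLens_getD, quotientParts,
    getD_filter_ne_zero (quotient_zipWith_pairwise lam a), List.getD_eq_getElem _ _ (by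
      simpa [replacedPart] using hj)]
  simp only [List.getElem_zipWith, replacedPart, List.getElem_reverse, List.getElem_map,
    List.getElem_range, List.length_map, List.length_range]
  omega

theorem rowLen_quotientComponent_eq_zero {lam : YoungDiagram} {a : ℕ} {j : ℕ}
    (hj : (betaPart lam a).length ≤ j) : (quotientComponent lam a).rowLen j = 0 := by
  rw [quotientComponent, rowLen_ofRowLens_getD, quotientParts,
    getD_filter_ne_zero (quotient_zipWith_pairwise lam a), List.getD_eq_default _ _ (by
      simpa [replacedPart] using hj)]

/-- The diagonal lengths of a component of the quotient have every second step of those of the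
diagram, provided that the number of components of `L` of the given parity is the balanced one. -/
theorem quotientComponent_diagLength_sub {lam : YoungDiagram} {a : ℕ} {r : ℤ} (ha : a < 2)
    (h0 : 0 ≤ r) (h1 : r ≤ 1)
    (hbal : 2 * ((betaPart lam a).length : ℤ) + a = lam.rowLens.length + r) (k : ℤ) :
    (diagLength (quotientComponent lam a) k : ℤ) - diagLength (quotientComponent lam a) (k + 1) =
      diagLength lam (2 * k + r) - diagLength lam (2 * k + r + 1) := by
  rw [diagLength_sub _ (fun i hi => rowLen_quotientComponent_eq_zero hi),
    diagLength_sub _ (fun i hi => rowLen_eq_zero hi)]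
  have e1 : #{i ∈ range (betaPart lam a).length | rowEnd (quotientComponent lam a) i = k} =
      #{i ∈ range lam.rowLens.length | rowEnd lam i = 2 * k + r} := by
    refine card_fiber_eq (rowEnd_strictAnti _) (rowEnd_strictAnti _) ?_
    constructor
    · rintro ⟨j, hj, h⟩
      have h2 := rowLen_quotientComponent hj
      obtain ⟨i, hi, h3⟩ := mem_betaList.1 (mem_betaPart.1 (List.getElem_mem hj)).1
      rw [← h2] at h3
      refine ⟨i, hi, ?_⟩
      simp only [rowEnd] at h h3 ⊢
      omega
    · rintro ⟨i, hi, h⟩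
      have hl : ((rowEnd lam i + lam.rowLens.length).toNat : ℤ) =
          rowEnd lam i + lam.rowLens.length := by
        simp only [rowEnd]
        omega
      have hm : (rowEnd lam i + lam.rowLens.length).toNat ∈ betaPart lam a :=
        mem_betaPart.2 ⟨mem_betaList.2 ⟨i, hi, hl⟩, by omega⟩
      obtain ⟨j, hj, h4⟩ := List.getElem_of_mem hm
      have h2 := rowLen_quotientComponent hj
      rw [h4] at h2
      refine ⟨j, hj, ?_⟩
      simp only [rowEnd] at h hl h2 ⊢
      omega
  have e2 : #{i ∈ range (betaPart lam a).length | -((i : ℕ) : ℤ) - 1 = k} =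
      #{i ∈ range lam.rowLens.length | -((i : ℕ) : ℤ) - 1 = 2 * k + r} := by
    refine card_fiber_eq neg_sub_one_strictAnti neg_sub_one_strictAnti ?_
    constructor
    · rintro ⟨j, hj, h⟩
      exact ⟨(-(2 * k + r) - 1).toNat, by omega, by omega⟩
    · rintro ⟨j, hj, h⟩
      exact ⟨(-k - 1).toNat, by omega, by omega⟩
  rw [e1, e2]

theorem length_betaPart (lam : YoungDiagram) (a : ℕ) :
    (betaPart lam a).length =
      #{i ∈ range lam.rowLens.length | (rowEnd lam i + lam.rowLens.length) % 2 = a} := by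
  have hn : (betaPart lam a).Nodup := (betaPart_pairwise lam a).imp fun {_ _} h => h.ne'
  rw [← List.toFinset_card_of_nodup hn]
  symm
  refine card_bij (fun i _ => (rowEnd lam i + lam.rowLens.length).toNat) ?_ ?_ ?_
  · intro i hi
    simp only [mem_filter, mem_range] at hi
    have hl : ((rowEnd lam i + lam.rowLens.length).toNat : ℤ) =
        rowEnd lam i + lam.rowLens.length := by
      simp only [rowEnd]
      omega
    rw [List.mem_toFinset, mem_betaPart, mem_betaList]
    exact ⟨⟨i, hi.1, hl⟩, by omega⟩
  · intro i hi j hj h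
    simp only [mem_filter, mem_range] at hi hj
    refine (rowEnd_strictAnti lam).injective ?_
    have h1 : 0 ≤ rowEnd lam i + lam.rowLens.length := by simp only [rowEnd]; omega
    have h2 : 0 ≤ rowEnd lam j + lam.rowLens.length := by simp only [rowEnd]; omega
    omega
  · intro l hl
    rw [List.mem_toFinset, mem_betaPart, mem_betaList] at hl
    obtain ⟨⟨i, hi, h⟩, h2⟩ := hl
    exact ⟨i, mem_filter.2 ⟨mem_range.2 hi, by omega⟩, by omega⟩

theorem card_odd_range (p : ℕ) : #{i ∈ range p | (-((i : ℕ) : ℤ) - 1) % 2 = 0} = p / 2 := by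
  induction p with
  | zero => rfl
  | succ p ih =>
    rw [range_add_one, filter_insert]
    split_ifs with h
    · rw [card_insert_of_notMem (by simp), ih]
      omega
    · rw [ih]
      omega

/-- In terms of the list `L`, a pavable diagram has empty 2-core.  The step from `D_{2k}` to
`D_{2(k+1)}` of the number of dominoes of type `1` is the number of rows with first box on
`D_{2k+1}` minus the number of rows with last box on `D_{2k}`, and these steps add up to zero. -/
theorem IsPaving.card_even_rowEnd {lam : YoungDiagram} {P : Finset Domino} (hP : IsPaving lam P) :
    #{i ∈ range lam.rowLens.length | rowEnd lam i % 2 = 0} = lam.rowLens.length / 2 := by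
  obtain ⟨p, hp⟩ : ∃ p, lam.rowLens.length = p := ⟨_, rfl⟩
  rw [hp]
  have hN : ∀ m, diagLength lam m = #{d ∈ P | d.topDiag = m} + #{d ∈ P | d.topDiag = m + 1} := by
    intro m
    simpa [diagLength] using hP.card_filter_cells (fun _ => True) m
  -- Used both for the ends of the rows and for the boxes before their starts.
  have hstep : ∀ (f : ℕ → ℤ) (k : ℤ), #{i ∈ range p | f i % 2 = 0 ∧ f i < 2 * (k + 1)} =
      #{i ∈ range p | f i % 2 = 0 ∧ f i < 2 * k} + #{i ∈ range p | f i = 2 * k} := by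
    intro f k
    rw [← card_union_of_disjoint, ← filter_or]
    · congr 1
      refine filter_congr fun i _ => ?_
      omega
    · refine disjoint_filter.2 fun i _ h h' => ?_
      omega
  obtain ⟨M, hM⟩ := (P.image Domino.topDiag).bddBelow
  obtain ⟨M', hM'⟩ := (P.image Domino.topDiag).bddAbove
  obtain ⟨R, hR⟩ := ((range p).image (rowEnd lam)).bddBelow
  obtain ⟨R', hR'⟩ := ((range p).image (rowEnd lam)).bddAbove
  have hzero : ∀ {m}, m < M ∨ M' < m → #{d ∈ P | d.topDiag = m} = 0 := by
    intro m hm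
    rw [card_eq_zero, filter_eq_empty_iff]
    rintro d hd rfl
    have h1 := hM (mem_coe.2 (mem_image_of_mem _ hd))
    have h2 := hM' (mem_coe.2 (mem_image_of_mem _ hd))
    omega
  have hlow : ∀ (f : ℕ → ℤ) (k : ℤ), (∀ i < p, 2 * k ≤ f i) →
      #{i ∈ range p | f i % 2 = 0 ∧ f i < 2 * k} = 0 := by
    intro f k h
    rw [card_eq_zero, filter_eq_empty_iff]
    intro i hi h'
    have := h i (mem_range.1 hi)
    omega
  have hhigh : ∀ (f : ℕ → ℤ) (k : ℤ), (∀ i < p, f i < 2 * k) →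
      #{i ∈ range p | f i % 2 = 0 ∧ f i < 2 * k} = #{i ∈ range p | f i % 2 = 0} := by
    intro f k h
    congr 1
    exact filter_congr fun i hi => and_iff_left (h i (mem_range.1 hi))
  have hRi : ∀ i < p, R ≤ rowEnd lam i ∧ rowEnd lam i ≤ R' := fun i hi =>
    ⟨hR (mem_coe.2 (mem_image_of_mem _ (mem_range.2 hi))),
      hR' (mem_coe.2 (mem_image_of_mem _ (mem_range.2 hi)))⟩
  have key := eq_of_increments_eq (f := fun k => (#{d ∈ P | d.topDiag = 2 * k} : ℤ))
    (g := fun k => (#{i ∈ range p | (-((i : ℕ) : ℤ) - 1) % 2 = 0 ∧ -(i : ℤ) - 1 < 2 * k} : ℤ) -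
      #{i ∈ range p | rowEnd lam i % 2 = 0 ∧ rowEnd lam i < 2 * k})
    (M := min (min M R) (-p) - 1)
    (fun k hk => by
      have := hzero (m := 2 * k) (by omega)
      simp only [this, Nat.cast_zero])
    (fun k hk => by
      rw [hlow _ k fun i hi => by omega, hlow _ k fun i hi => by
        have := hRi i hi
        omega]
      rfl)
    (fun k => by
      have h1 := diagLength_sub lam (q := p) (fun i hi => rowLen_eq_zero (hp ▸ hi)) (2 * k)
      have h2 := hN (2 * k)
      have h3 := hN (2 * k + 1)
      have h4 := hstep (rowEnd lam) k
      have h5 := hstep (fun i => -(i : ℤ) - 1) k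
      rw [show 2 * k + 1 + 1 = 2 * (k + 1) by ring] at h3
      push_cast [h4, h5]
      omega)
    (max (max M' R') 0 + 1)
  rw [hzero (by omega), hhigh _ _ fun i hi => by omega, hhigh _ _ fun i hi => by
    have := hRi i hi
    omega, card_odd_range] at key
  omega

theorem IsPaving.hasTwoQuotient_of_balanced {lam : YoungDiagram} {P : Finset Domino}
    (hP : IsPaving lam P) {a b : ℕ} (ha : a < 2) (hb : b < 2)
    (hbal : 2 * (betaPart lam a).length + a = lam.rowLens.length)
    (hbal' : 2 * (betaPart lam b).length + b = lam.rowLens.length + 1) :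
    HasTwoQuotient lam (quotientComponent lam a) (quotientComponent lam b) := by
  have hN : ∀ m, diagLength lam m = #{d ∈ P | d.topDiag = m} + #{d ∈ P | d.topDiag = m + 1} := by
    intro m
    simpa [diagLength] using hP.card_filter_cells (fun _ => True) m
  obtain ⟨M, hM⟩ := (P.image Domino.topDiag).bddBelow
  have hzero : ∀ {m}, m < M → #{d ∈ P | d.topDiag = m} = 0 := by
    intro m hm
    rw [card_eq_zero, filter_eq_empty_iff]
    rintro d hd rfl
    exact hm.not_ge (hM (mem_coe.2 (mem_image_of_mem _ hd)))
  -- The numbers of dominoes and the diagonal lengths of the component have the same steps.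
  have heq : ∀ (a : ℕ) (r : ℤ), a < 2 → 0 ≤ r → r ≤ 1 →
      2 * ((betaPart lam a).length : ℤ) + a = lam.rowLens.length + r → ∀ k,
      #{d ∈ P | d.topDiag = 2 * k + r} = diagLength (quotientComponent lam a) k := by
    intro a r ha h0 h1 hbal k
    obtain ⟨M', hM'⟩ := exists_lower_bound_diagLength (quotientComponent lam a)
    have := eq_of_increments_eq (f := fun k => (#{d ∈ P | d.topDiag = 2 * k + r} : ℤ))
      (g := fun k => (diagLength (quotientComponent lam a) k : ℤ)) (M := min (min M M') 0 - 1)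
      (fun m hm => by
        have := hzero (m := 2 * m + r) (by omega)
        simp only [this, Nat.cast_zero])
      (fun m hm => by
        have := hM' m (by omega)
        simp only [this, Nat.cast_zero])
      (fun m => by
        have h1 := quotientComponent_diagLength_sub ha h0 h1 hbal m
        have h2 := hN (2 * m + r)
        have h3 := hN (2 * m + r + 1)
        rw [show 2 * m + r + 1 + 1 = 2 * (m + 1) + r by ring] at h3
        omega) k
    exact_mod_cast this
  have e1 := heq a 0 ha le_rfl zero_le_one (by exact_mod_cast hbal)
  have e2 := heq b 1 hb zero_le_one le_rfl (by exact_mod_cast hbal')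
  intro k
  rw [hN, hN, ← e1, ← e1, ← e2, add_zero, add_zero,
    show 2 * k + 1 + 1 = 2 * (k + 1) by ring]
  exact ⟨rfl, rfl⟩

/-- For a pavable diagram, the component of the even numbers counts the dominoes of type
`muType lam` and the component of the odd numbers those of type `nuType lam`. -/
theorem Pavable.hasTwoQuotient {lam : YoungDiagram} (h : Pavable lam) :
    (Even lam.rowLens.length →
      HasTwoQuotient lam (quotientComponent lam 0) (quotientComponent lam 1)) ∧
    (¬Even lam.rowLens.length →
      HasTwoQuotient lam (quotientComponent lam 1) (quotientComponent lam 0)) := by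
  obtain ⟨P, hP⟩ := h
  have h1 := hP.card_even_rowEnd
  have h2 := length_betaPart lam 0
  have h3 := length_betaPart lam 1
  have h4 : #{i ∈ range lam.rowLens.length | rowEnd lam i % 2 = 0} +
      #{i ∈ range lam.rowLens.length | ¬rowEnd lam i % 2 = 0} = lam.rowLens.length := by
    rw [card_filter_add_card_filter_not, card_range]
  constructor
  · intro he
    have he := Nat.even_iff.1 he
    rw [filter_congr (q := fun i => rowEnd lam i % 2 = 0) fun i _ => by omega] at h2
    rw [filter_congr (q := fun i => ¬rowEnd lam i % 2 = 0) fun i _ => by omega] at h3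
    exact hP.hasTwoQuotient_of_balanced (by norm_num) (by norm_num) (by omega) (by omega)
  · intro he
    have he := Nat.not_even_iff.1 he
    rw [filter_congr (q := fun i => ¬rowEnd lam i % 2 = 0) fun i _ => by omega] at h2
    rw [filter_congr (q := fun i => rowEnd lam i % 2 = 0) fun i _ => by omega] at h3
    exact hP.hasTwoQuotient_of_balanced (by norm_num) (by norm_num) (by omega) (by omega)

/-! ### The southeast relation -/

theorem Domino.WeaklySoutheast.exists_box {d e : Domino} (h : e.WeaklySoutheast d) :
    ∃ c ∈ e.boxes, d.fstBox ≤ c := by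
  obtain ⟨c, hc, h1, h2⟩ := h
  exact ⟨c, hc, h1, h2⟩

theorem IsDominoFilling.key_le_of_southeast {lam : YoungDiagram} {P : Finset Domino}
    {g : Domino → ℕ} (hP : IsPaving lam P) (hg : IsDominoFilling P g) {d e : Domino} (hd : d ∈ P)
    (he : e ∈ P) (h : e.WeaklySoutheast d) : d.key g ≤ e.key g := by
  obtain ⟨c, hc, hle⟩ := h.exists_box
  exact hg.key_le hP hd he (by simp [Domino.boxes]) hc hle

/-- Dominoes of the same type on consecutive lines `D_{2k}`, `D_{2(k+1)}` are comparable. -/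
theorem Domino.southeast_total {d e : Domino} (h : e.topDiag = d.topDiag + 2) :
    e.WeaklySoutheast d ∨ d.WeaklySoutheast e := by
  obtain ⟨r, c, b⟩ := d
  obtain ⟨r', c', b'⟩ := e
  cases b <;> cases b' <;>
    simp [topDiag, upperBox, content, WeaklySoutheast, boxes, fstBox, sndBox] at h ⊢ <;> omega

/-- In a domino filling, the southeast relation between dominoes of the same type on consecutive
lines is decided by their entries. -/
theorem IsDominoFilling.southeast_iff {lam : YoungDiagram} {P : Finset Domino}
    {g : Domino → ℕ} (hP : IsPaving lam P) (hg : IsDominoFilling P g) {d e : Domino} (hd : d ∈ P)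
    (he : e ∈ P) (h : e.topDiag = d.topDiag + 2) :
    (e.WeaklySoutheast d ↔ g d ≤ g e) ∧ (d.WeaklySoutheast e ↔ g e < g d) := by
  have h1 : e.WeaklySoutheast d → g d ≤ g e := fun hse => by
    have := mkKey_le_iff.1 (hg.key_le_of_southeast hP hd he hse)
    omega
  have h2 : d.WeaklySoutheast e → g e < g d := fun hse => by
    have := mkKey_le_iff.1 (hg.key_le_of_southeast hP he hd hse)
    omega
  refine ⟨⟨h1, fun hle => ?_⟩, ⟨h2, fun hlt => ?_⟩⟩
  · exact (Domino.southeast_total h).resolve_right fun hse => (h2 hse).not_ge hle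
  · exact (Domino.southeast_total h).resolve_left fun hse => (h1 hse).not_gt hlt

theorem le_or_le_of_content_eq {c c' : ℕ × ℕ} (h : content c' = content c + 1) :
    c ≤ c' ∨ c' ≤ c ∧ c'.1 < c.1 := by
  simp only [content, Prod.le_def] at *
  omega

/-! ### Set-valued fillings -/

theorem minEntry_mem {A : Finset ℕ} (hA : A.Nonempty) : minEntry A ∈ A := by
  rw [minEntry, dif_pos hA]
  exact A.min'_mem hA

theorem minEntry_singleton (a : ℕ) : minEntry {a} = a := by
  simp [minEntry]

theorem SetLE.minEntry_le {A B : Finset ℕ} (h : SetLE A B) (hA : A.Nonempty) (hB : B.Nonempty) :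
    minEntry A ≤ minEntry B :=
  h _ (minEntry_mem hA) _ (minEntry_mem hB)

theorem SetLT.minEntry_lt {A B : Finset ℕ} (h : SetLT A B) (hA : A.Nonempty) (hB : B.Nonempty) :
    minEntry A < minEntry B :=
  h _ (minEntry_mem hA) _ (minEntry_mem hB)

theorem SetLE.trans {A B C : Finset ℕ} (h : SetLE A B) (h' : SetLE B C) (hB : B.Nonempty) :
    SetLE A C := by
  obtain ⟨b, hb⟩ := hB
  exact fun a ha c hc => (h a ha b hb).trans (h' b hb c hc)

theorem SetLE.trans_lt {A B C : Finset ℕ} (h : SetLE A B) (h' : SetLT B C) (hB : B.Nonempty) :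
    SetLT A C := by
  obtain ⟨b, hb⟩ := hB
  exact fun a ha c hc => (h a ha b hb).trans_lt (h' b hb c hc)

theorem SetLT.le {A B : Finset ℕ} (h : SetLT A B) : SetLE A B :=
  fun a ha b hb => (h a ha b hb).le

theorem SetLT.trans {A B C : Finset ℕ} (h : SetLT A B) (h' : SetLT B C) (hB : B.Nonempty) :
    SetLT A C :=
  h.le.trans_lt h' hB

section SetValued

variable {sig : YoungDiagram}

theorem SetValuedTableau.isSemistandardFilling (t : SetValuedTableau sig) :
    IsSemistandardFilling sig fun i j => minEntry (t.entry i j) := by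
  refine ⟨fun i j j' hj hc => ?_, fun i i' j hi hc => ?_⟩
  · exact (t.row_weak i j j' hj hc).minEntry_le
      (t.nonempty _ _ (sig.isLowerSet (Prod.mk_le_mk.2 ⟨le_rfl, hj.le⟩) hc)) (t.nonempty _ _ hc)
  · exact (t.col_strict i i' j hi hc).minEntry_lt
      (t.nonempty _ _ (sig.isLowerSet (Prod.mk_le_mk.2 ⟨hi.le, le_rfl⟩) hc)) (t.nonempty _ _ hc)

theorem SetValuedTableau.setLT (t : SetValuedTableau sig) {c c' : ℕ × ℕ} (h : c ≤ c')
    (hlt : c.1 < c'.1) (hc' : c' ∈ sig) : SetLT (t.entry c.1 c.2) (t.entry c'.1 c'.2) := by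
  have hm : (c.1, c'.2) ∈ sig := sig.isLowerSet (Prod.mk_le_mk.2 ⟨h.1, le_rfl⟩) hc'
  rcases h.2.lt_or_eq with h2 | h2
  · exact (t.row_weak _ _ _ h2 hm).trans_lt (t.col_strict _ _ _ hlt hc') (t.nonempty _ _ hm)
  · rw [h2]
    exact t.col_strict _ _ _ hlt hc'

theorem SetValuedTableau.setLE (t : SetValuedTableau sig) {c c' : ℕ × ℕ} (h : c ≤ c')
    (hne : c ≠ c') (hc' : c' ∈ sig) : SetLE (t.entry c.1 c.2) (t.entry c'.1 c'.2) := by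
  rcases h.1.lt_or_eq with h1 | h1
  · exact (t.setLT h h1 hc').le
  · rw [h1]
    refine t.row_weak _ _ _ (lt_of_le_of_ne h.2 fun h2 => hne (Prod.ext h1 h2)) hc'

/-- The entries of boxes on consecutive diagonals are compared by their minima. -/
theorem SetValuedTableau.setLE_of_minEntry_le (t : SetValuedTableau sig) {c c' : ℕ × ℕ}
    (h : content c' = content c + 1) (hc : c ∈ sig) (hc' : c' ∈ sig) :
    (minEntry (t.entry c.1 c.2) ≤ minEntry (t.entry c'.1 c'.2) →
      SetLE (t.entry c.1 c.2) (t.entry c'.1 c'.2)) ∧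
    (minEntry (t.entry c'.1 c'.2) < minEntry (t.entry c.1 c.2) →
      SetLT (t.entry c'.1 c'.2) (t.entry c.1 c.2)) := by
  rcases le_or_le_of_content_eq h with hle | ⟨hle, hlt⟩
  · have hLE := t.setLE hle (by rintro rfl; omega) hc'
    exact ⟨fun _ => hLE, fun hlt =>
      absurd (hLE.minEntry_le (t.nonempty _ _ hc) (t.nonempty _ _ hc')) hlt.not_ge⟩
  · have hLT := t.setLT hle hlt hc
    exact ⟨fun hle => absurd (hLT.minEntry_lt (t.nonempty _ _ hc') (t.nonempty _ _ hc)) hle.not_gt,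
      fun _ => hLT⟩

theorem SetValuedTableau.eq_of_reading_eq {t t' : SetValuedTableau sig}
    (h : ∀ k, t.reading k = t'.reading k) : t = t' := by
  ext i j : 3
  by_cases hij : (i, j) ∈ sig
  · rw [eq_of_cellWord_eq (c := (i, j)) h hij]
  · rw [t.empties i j hij, t'.empties i j hij]

theorem PosSSYT.isSemistandardFilling (t : PosSSYT sig) :
    IsSemistandardFilling sig fun i j => t.1 i j :=
  ⟨fun _ _ _ => t.1.row_weak, fun _ _ _ => t.1.col_strict⟩

theorem PosSSYT.eq_of_reading_eq {t t' : PosSSYT sig} (h : ∀ k, t.reading k = t'.reading k) :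
    t = t' := by
  apply Subtype.ext
  ext i j
  by_cases hij : (i, j) ∈ sig
  · exact eq_of_cellWord_eq (t := fun i j => t.1 i j) (t' := fun i j => t'.1 i j) (c := (i, j))
      h hij
  · rw [t.1.zeros hij, t'.1.zeros hij]

end SetValued

/-! ### The two correspondences -/

section Correspondence

variable {lam sig sig₁ sig₂ : YoungDiagram}

theorem DominoTableau.exists_posSSYT (S : DominoTableau lam) {s : ℕ} {r : ℤ}
    (hs : IsTypeOffset s r)
    (hcard : ∀ k, #{z ∈ S.tiles.image (Domino.key S.entry) | z.diag = 2 * k + r} =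
      diagLength sig k) :
    ∃ t : PosSSYT sig, ∀ k, t.reading k = S.reading s k := by
  obtain ⟨t, ht, hword, hz⟩ := exists_cellFilling (val := id) S.isPaving S.isFilling hs hcard 0
  refine ⟨⟨⟨t, fun h hc => ht.1 _ _ _ h hc, fun h hc => ht.2 _ _ _ h hc, fun h => hz _ _ h⟩,
    fun i j hij => ?_⟩, hword⟩
  obtain ⟨d, hd, -, h⟩ := ((cellWord_eq_tileWord_iff (val := id) S.isPaving S.isFilling ht hs).1
    (hword (content (i, j))) _).1 ⟨(i, j), hij, rfl, rfl⟩
  exact lt_of_lt_of_eq (S.pos d hd) h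

theorem SetValuedDominoTableau.exists_setValuedTableau (T : SetValuedDominoTableau lam) {s : ℕ}
    {r : ℤ} (hs : IsTypeOffset s r)
    (hcard : ∀ k, #{z ∈ T.tiles.image (Domino.key fun d => minEntry (T.entry d)) |
      z.diag = 2 * k + r} = diagLength sig k) :
    ∃ t : SetValuedTableau sig, ∀ k, t.reading k = T.reading s k := by
  obtain ⟨t, ht, hword, hz⟩ := exists_cellFilling T.isPaving T.min_isFilling hs hcard ∅
  have htile : ∀ i j, (i, j) ∈ sig → ∃ d ∈ T.tiles, d.topDiag = 2 * content (i, j) + r ∧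
      T.entry d = t i j := fun i j hij =>
    ((cellWord_eq_tileWord_iff T.isPaving T.min_isFilling ht hs).1 (hword _) _).1
      ⟨(i, j), hij, rfl, rfl⟩
  have hne : ∀ i j, (i, j) ∈ sig → (t i j).Nonempty := by
    intro i j hij
    obtain ⟨d, hd, -, h⟩ := htile i j hij
    exact h ▸ T.nonempty d hd
  have hrow : ∀ i j, (i, j + 1) ∈ sig → SetLE (t i j) (t i (j + 1)) := by
    intro i j hij
    obtain ⟨d, hd, hdm, hdt⟩ :=
      htile i j (sig.isLowerSet (Prod.mk_le_mk.2 ⟨le_rfl, j.le_succ⟩) hij)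
    obtain ⟨e, he, hem, het⟩ := htile i (j + 1) hij
    have hcont : content (i, j + 1) = content (i, j) + 1 := by simp only [content]; omega
    rw [hcont] at hem
    have hle := ht.1 i j (j + 1) j.lt_succ_self hij
    beta_reduce at hle
    rw [← hdt, ← het] at hle ⊢
    have h1 := hs.onDiag_and_type_iff.2 hdm
    have h2 := hs.onDiag_and_type_iff.2 hem
    exact T.weak d hd e he _ (h1.2.trans h2.2.symm)
      ((T.min_isFilling.southeast_iff T.isPaving hd he (by omega)).1.2 hle) h1.1 h2.1
  have hcol : ∀ i j, (i + 1, j) ∈ sig → SetLT (t i j) (t (i + 1) j) := by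
    intro i j hij
    obtain ⟨d, hd, hdm, hdt⟩ :=
      htile i j (sig.isLowerSet (Prod.mk_le_mk.2 ⟨i.le_succ, le_rfl⟩) hij)
    obtain ⟨e, he, hem, het⟩ := htile (i + 1) j hij
    have hcont : content (i, j) = content (i + 1, j) + 1 := by simp only [content]; omega
    rw [hcont] at hdm
    have hlt := ht.2 i (i + 1) j i.lt_succ_self hij
    beta_reduce at hlt
    rw [← hdt, ← het] at hlt ⊢
    have h1 := hs.onDiag_and_type_iff.2 hdm
    have h2 := hs.onDiag_and_type_iff.2 hem
    exact T.strict d hd e he _ (h1.2.trans h2.2.symm)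
      ((T.min_isFilling.southeast_iff T.isPaving he hd (by omega)).2.2 hlt) h1.1 h2.1
  refine ⟨⟨t, hne, fun i j hij a ha => ?_, fun i j j' hj hc => ?_, fun i i' j hi hc => ?_, hz⟩,
    hword⟩
  · obtain ⟨d, hd, -, h⟩ := htile i j hij
    exact T.pos d hd a (h ▸ ha)
  · induction j', Nat.succ_le_of_lt hj using Nat.le_induction with
    | base => exact hrow i j hc
    | succ j' hj' ih =>
      have hc' : (i, j') ∈ sig := sig.isLowerSet (Prod.mk_le_mk.2 ⟨le_rfl, j'.le_succ⟩) hc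
      exact (ih (Nat.lt_of_succ_le hj') hc').trans (hrow i j' hc) (hne _ _ hc')
  · induction i', Nat.succ_le_of_lt hi using Nat.le_induction with
    | base => exact hcol i j hc
    | succ i' hi' ih =>
      have hc' : (i', j) ∈ sig := sig.isLowerSet (Prod.mk_le_mk.2 ⟨i'.le_succ, le_rfl⟩) hc
      exact (ih (Nat.lt_of_succ_le hi') hc').trans (hcol i' j hc) (hne _ _ hc')

/-- Every domino corresponds to a box with the same label. -/
theorem IsPaving.exists_cell {α : Type*} {P : Finset Domino} {f : Domino → α} {t₁ t₂ : ℕ → ℕ → α}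
    (hP : IsPaving lam P) (h₁ : ∀ k, cellWord sig₁ t₁ k = tileWord lam P f 1 k)
    (h₂ : ∀ k, cellWord sig₂ t₂ k = tileWord lam P f 2 k) {d : Domino} (hd : d ∈ P) :
    (∃ c ∈ sig₁, d.topDiag = 2 * content c ∧ t₁ c.1 c.2 = f d) ∨
      ∃ c ∈ sig₂, d.topDiag = 2 * content c + 1 ∧ t₂ c.1 c.2 = f d := by
  rcases d.topDiag.even_or_odd' with ⟨k, hk | hk⟩
  · have h : f d ∈ tileWord lam P f 1 k :=
      (hP.mem_tileWord (Or.inl ⟨rfl, rfl⟩)).2 ⟨d, hd, by rw [hk, add_zero], rfl⟩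
    rw [← h₁, mem_cellWord] at h
    obtain ⟨c, hc, rfl, h⟩ := h
    exact Or.inl ⟨c, hc, hk, h⟩
  · have h : f d ∈ tileWord lam P f 2 k := (hP.mem_tileWord (Or.inr ⟨rfl, rfl⟩)).2 ⟨d, hd, hk, rfl⟩
    rw [← h₂, mem_cellWord] at h
    obtain ⟨c, hc, rfl, h⟩ := h
    exact Or.inr ⟨c, hc, hk, h⟩

theorem Domino.topDiag_eq_add_two {d e : Domino} {k : ℤ} (h : d.type = e.type) (hd : d.OnDiag k)
    (he : e.OnDiag (k + 1)) : e.topDiag = d.topDiag + 2 := by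
  rw [onDiag_iff] at hd he
  rw [type_eq, type_eq] at h
  split_ifs at h with h1 h2 h2 <;> simp only [Int.even_iff] at h1 h2 <;> omega

theorem HasTwoQuotient.exists_dominoTableau (hq : HasTwoQuotient lam sig₁ sig₂) (t₁ : PosSSYT sig₁)
    (t₂ : PosSSYT sig₂) :
    ∃ S : DominoTableau lam, ∀ k, t₁.reading k = S.reading 1 k ∧ t₂.reading k = S.reading 2 k := by
  obtain ⟨P, f, hP, hf, h₁, h₂, hz⟩ := exists_tileFilling (val := id) hq
    t₁.isSemistandardFilling t₂.isSemistandardFilling 0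
  refine ⟨⟨P, f, hP, fun d hd => ?_, hf, hz⟩, fun k => ⟨h₁ k, h₂ k⟩⟩
  rcases hP.exists_cell h₁ h₂ hd with ⟨c, hc, -, h⟩ | ⟨c, hc, -, h⟩
  · exact h ▸ t₁.2 _ _ hc
  · exact h ▸ t₂.2 _ _ hc

theorem HasTwoQuotient.exists_setValuedDominoTableau (hq : HasTwoQuotient lam sig₁ sig₂)
    (t₁ : SetValuedTableau sig₁) (t₂ : SetValuedTableau sig₂) :
    ∃ T : SetValuedDominoTableau lam,
      ∀ k, t₁.reading k = T.reading 1 k ∧ t₂.reading k = T.reading 2 k := by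
  obtain ⟨P, f, hP, hf, h₁, h₂, hz⟩ := exists_tileFilling hq
    t₁.isSemistandardFilling t₂.isSemistandardFilling ∅
  -- Labels of dominoes of the same type on consecutive lines are compared by their minima, since
  -- those of the corresponding boxes are.
  have hcomp : ∀ d ∈ P, ∀ e ∈ P, e.topDiag = d.topDiag + 2 →
      (minEntry (f d) ≤ minEntry (f e) → SetLE (f d) (f e)) ∧
      (minEntry (f e) < minEntry (f d) → SetLT (f e) (f d)) := by
    intro d hd e he hde
    rcases hP.exists_cell h₁ h₂ hd with ⟨c, hc, hcm, h⟩ | ⟨c, hc, hcm, h⟩ <;>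
      rcases hP.exists_cell h₁ h₂ he with ⟨c', hc', hcm', h'⟩ | ⟨c', hc', hcm', h'⟩
    · rw [← h, ← h']
      exact t₁.setLE_of_minEntry_le (by omega) hc hc'
    · omega
    · omega
    · rw [← h, ← h']
      exact t₂.setLE_of_minEntry_le (by omega) hc hc'
  refine ⟨⟨P, f, hP, fun d hd => ?_, fun d hd => ?_, hf, fun d hd e he k ht hse hdk hek => ?_,
    fun d hd e he k ht hse hdk hek => ?_, hz⟩, fun k => ⟨h₁ k, h₂ k⟩⟩
  · rcases hP.exists_cell h₁ h₂ hd with ⟨c, hc, -, h⟩ | ⟨c, hc, -, h⟩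
    · exact h ▸ t₁.nonempty _ _ hc
    · exact h ▸ t₂.nonempty _ _ hc
  · rcases hP.exists_cell h₁ h₂ hd with ⟨c, hc, -, h⟩ | ⟨c, hc, -, h⟩
    · exact h ▸ t₁.pos _ _ hc
    · exact h ▸ t₂.pos _ _ hc
  · have hde := Domino.topDiag_eq_add_two ht hdk hek
    exact (hcomp d hd e he hde).1 ((hf.southeast_iff hP hd he hde).1.1 hse)
  · have hde := Domino.topDiag_eq_add_two ht.symm hek hdk
    exact (hcomp e he d hd hde).2 ((hf.southeast_iff hP he hd hde).2.1 hse)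

theorem DominoTableau.eq_of_reading_eq {S S' : DominoTableau lam}
    (h : ∀ k, S.reading 1 k = S'.reading 1 k ∧ S.reading 2 k = S'.reading 2 k) : S = S' := by
  obtain ⟨h1, h2⟩ := IsDominoFilling.eq_of_tileWord_eq (val := id) S.isPaving S.isFilling
    S'.isPaving S'.isFilling (fun k => (h k).1) fun k => (h k).2
  refine DominoTableau.ext h1 (funext fun d => ?_)
  by_cases hd : d ∈ S.tiles
  · exact h2 d hd
  · rw [S.zeros d hd, S'.zeros d (h1 ▸ hd)]

theorem SetValuedDominoTableau.eq_of_reading_eq {T T' : SetValuedDominoTableau lam}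
    (h : ∀ k, T.reading 1 k = T'.reading 1 k ∧ T.reading 2 k = T'.reading 2 k) : T = T' := by
  obtain ⟨h1, h2⟩ := IsDominoFilling.eq_of_tileWord_eq (val := minEntry) T.isPaving
    T.min_isFilling T'.isPaving T'.min_isFilling (fun k => (h k).1) fun k => (h k).2
  refine SetValuedDominoTableau.ext h1 (funext fun d => ?_)
  by_cases hd : d ∈ T.tiles
  · exact h2 d hd
  · rw [T.empties d hd, T'.empties d (h1 ▸ hd)]

/-- Replacing the entries of a domino tableau by singletons gives a set-valued domino tableau:
the conditions on dominoes of the same type are consequences of those on rows and columns. -/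
theorem DominoTableau.exists_singletons (S : DominoTableau lam) :
    ∃ T : SetValuedDominoTableau lam, T.tiles = S.tiles ∧
      (∀ d ∈ S.tiles, T.entry d = {S.entry d}) ∧
      ∀ s k, T.reading s k = (S.reading s k).map fun a => {a} := by
  set f : Domino → Finset ℕ := fun d => if d ∈ S.tiles then {S.entry d} else ∅ with hfdef
  have hf : ∀ d ∈ S.tiles, f d = {S.entry d} := fun d hd => if_pos hd
  have hmin : ∀ d ∈ S.tiles, minEntry (f d) = S.entry d := fun d hd => by
    rw [hf d hd, minEntry_singleton]
  refine ⟨⟨S.tiles, f, S.isPaving, fun d hd => ?_, fun d hd a ha => ?_, ⟨?_, ?_⟩,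
    fun d hd e he k ht hse hdk hek => ?_, fun d hd e he k ht hse hdk hek => ?_,
    fun d hd => if_neg hd⟩, rfl, hf, fun s k => ?_⟩
  · simp [hf d hd]
  · rw [hf d hd, mem_singleton] at ha
    exact ha ▸ S.pos d hd
  · intro d hd e he i j j' hc hc' h
    beta_reduce
    rw [hmin d hd, hmin e he]
    exact S.isFilling.1 d hd e he i j j' hc hc' h
  · intro d hd e he i i' j hc hc' h hne
    beta_reduce
    rw [hmin d hd, hmin e he]
    exact S.isFilling.2 d hd e he i i' j hc hc' h hne
  · have := (S.isFilling.southeast_iff S.isPaving hd he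
      (Domino.topDiag_eq_add_two ht hdk hek)).1.1 hse
    rw [hf d hd, hf e he]
    simpa [SetLE] using this
  · have := (S.isFilling.southeast_iff S.isPaving he hd
      (Domino.topDiag_eq_add_two ht.symm hek hdk)).2.1 hse
    rw [hf d hd, hf e he]
    simpa [SetLT] using this
  · rw [SetValuedDominoTableau.reading, DominoTableau.reading, List.map_map]
    refine List.map_congr_left fun d hd => hf d ?_
    have h := (List.mem_filter.1 hd).1
    rw [S.isPaving.dominoesOnDiag_eq, List.mem_map] at h
    obtain ⟨c, hc, rfl⟩ := h
    exact (S.isPaving.tileAt_mem (mem_diagBoxes.1 hc).1).1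

theorem exists_equiv_of_existsUnique {α β : Type*} {R : α → β → Prop} (h : ∀ a, ∃! b, R a b)
    (h' : ∀ b, ∃! a, R a b) : ∃ e : α ≃ β, ∀ a, R a (e a) := by
  choose f hf using fun a => (h a).exists
  refine ⟨Equiv.ofBijective f ⟨fun a a' haa' => ?_, fun b => ?_⟩, hf⟩
  · exact (h' (f a)).unique (hf a) (haa' ▸ hf a')
  · obtain ⟨a, ha, -⟩ := h' b
    exact ⟨a, (h a).unique (hf a) ha⟩

theorem HasTwoQuotient.exists_equiv (hq : HasTwoQuotient lam sig₁ sig₂) :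
    ∃ e : DominoTableau lam ≃ PosSSYT sig₁ × PosSSYT sig₂, ∀ S k,
      (e S).1.reading k = S.reading 1 k ∧ (e S).2.reading k = S.reading 2 k := by
  refine exists_equiv_of_existsUnique (R := fun (S : DominoTableau lam)
    (t : PosSSYT sig₁ × PosSSYT sig₂) =>
    ∀ k, t.1.reading k = S.reading 1 k ∧ t.2.reading k = S.reading 2 k) (fun S => ?_) fun t => ?_
  · have hcard := hq.card_eq (S.isFilling.diagLength_eq S.isPaving)
    obtain ⟨t₁, h₁⟩ := S.exists_posSSYT (sig := sig₁) (Or.inl ⟨rfl, rfl⟩)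
      fun k => by rw [add_zero]; exact (hcard k).1
    obtain ⟨t₂, h₂⟩ := S.exists_posSSYT (sig := sig₂) (Or.inr ⟨rfl, rfl⟩) fun k => (hcard k).2
    refine ⟨(t₁, t₂), fun k => ⟨h₁ k, h₂ k⟩, fun t ht => Prod.ext ?_ ?_⟩
    · exact PosSSYT.eq_of_reading_eq fun k => (ht k).1.trans (h₁ k).symm
    · exact PosSSYT.eq_of_reading_eq fun k => (ht k).2.trans (h₂ k).symm
  · obtain ⟨S, hS⟩ := hq.exists_dominoTableau t.1 t.2
    exact ⟨S, hS, fun S' hS' => DominoTableau.eq_of_reading_eq fun k =>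
      ⟨(hS' k).1.symm.trans (hS k).1, (hS' k).2.symm.trans (hS k).2⟩⟩

theorem HasTwoQuotient.exists_setValued_equiv (hq : HasTwoQuotient lam sig₁ sig₂) :
    ∃ e : SetValuedDominoTableau lam ≃ SetValuedTableau sig₁ × SetValuedTableau sig₂, ∀ T k,
      (e T).1.reading k = T.reading 1 k ∧ (e T).2.reading k = T.reading 2 k := by
  refine exists_equiv_of_existsUnique (R := fun (T : SetValuedDominoTableau lam)
    (t : SetValuedTableau sig₁ × SetValuedTableau sig₂) =>
    ∀ k, t.1.reading k = T.reading 1 k ∧ t.2.reading k = T.reading 2 k) (fun T => ?_) fun t => ?_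
  · have hcard := hq.card_eq (T.min_isFilling.diagLength_eq T.isPaving)
    obtain ⟨t₁, h₁⟩ := T.exists_setValuedTableau (sig := sig₁) (Or.inl ⟨rfl, rfl⟩)
      fun k => by rw [add_zero]; exact (hcard k).1
    obtain ⟨t₂, h₂⟩ := T.exists_setValuedTableau (sig := sig₂) (Or.inr ⟨rfl, rfl⟩)
      fun k => (hcard k).2
    refine ⟨(t₁, t₂), fun k => ⟨h₁ k, h₂ k⟩, fun t ht => Prod.ext ?_ ?_⟩
    · exact SetValuedTableau.eq_of_reading_eq fun k => (ht k).1.trans (h₁ k).symm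
    · exact SetValuedTableau.eq_of_reading_eq fun k => (ht k).2.trans (h₂ k).symm
  · obtain ⟨T, hT⟩ := hq.exists_setValuedDominoTableau t.1 t.2
    exact ⟨T, hT, fun T' hT' => SetValuedDominoTableau.eq_of_reading_eq fun k =>
      ⟨(hT' k).1.symm.trans (hT k).1, (hT' k).2.symm.trans (hT k).2⟩⟩

theorem SetValuedTableau.entry_eq_singleton {t : SetValuedTableau sig} {u : PosSSYT sig}
    (h : ∀ k, t.reading k = (u.reading k).map fun a => {a}) (i j : ℕ) (hij : (i, j) ∈ sig) :
    t.entry i j = {u.1 i j} := by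
  refine eq_of_cellWord_eq (t := t.entry) (t' := fun i j => {u.1 i j}) (c := (i, j))
    (fun k => (h k).trans ?_) hij
  rw [PosSSYT.reading, List.map_map]
  rfl

end Correspondence

/-- `Γs` splits the diagonal reading words of set-valued domino tableaux by type, `Γ` is the
classical bijection for domino tableaux, and `Γs` agrees with `Γ` on singleton-valued fillings. -/
theorem mainTheorem1 (lam mu nu : YoungDiagram) (hpav : Pavable lam)
    (hquot : twoQuotient lam = (mu, nu)) :
    ∃ (Γs : SetValuedDominoTableau lam ≃ SetValuedTableau mu × SetValuedTableau nu)
      (Γ : DominoTableau lam ≃ PosSSYT mu × PosSSYT nu),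
      (∀ (T : SetValuedDominoTableau lam) (k : ℤ),
        (Γs T).1.reading k = T.reading (muType lam) k ∧
        (Γs T).2.reading k = T.reading (nuType lam) k) ∧
      (∀ (S : DominoTableau lam) (k : ℤ),
        (Γ S).1.reading k = S.reading (muType lam) k ∧
        (Γ S).2.reading k = S.reading (nuType lam) k) ∧
      (∀ S : DominoTableau lam, ∃ T : SetValuedDominoTableau lam,
        T.tiles = S.tiles ∧ (∀ d ∈ S.tiles, T.entry d = {S.entry d}) ∧
        (∀ i j, (i, j) ∈ mu → (Γs T).1.entry i j = {(Γ S).1.1 i j}) ∧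
        (∀ i j, (i, j) ∈ nu → (Γs T).2.entry i j = {(Γ S).2.1 i j})) := by
  obtain rfl : mu = quotientComponent lam 0 := (congrArg Prod.fst hquot).symm
  obtain rfl : nu = quotientComponent lam 1 := (congrArg Prod.snd hquot).symm
  -- The bijections exist in both cases, up to the order of the two components.
  have hbij : ∃ (Γs : SetValuedDominoTableau lam ≃
        SetValuedTableau (quotientComponent lam 0) × SetValuedTableau (quotientComponent lam 1))
      (Γ : DominoTableau lam ≃
        PosSSYT (quotientComponent lam 0) × PosSSYT (quotientComponent lam 1)),
      (∀ T k, (Γs T).1.reading k = T.reading (muType lam) k ∧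
        (Γs T).2.reading k = T.reading (nuType lam) k) ∧
      ∀ S k, (Γ S).1.reading k = S.reading (muType lam) k ∧
        (Γ S).2.reading k = S.reading (nuType lam) k := by
    by_cases hp : Even lam.rowLens.length
    · have hq := hpav.hasTwoQuotient.1 hp
      obtain ⟨Γs, hs⟩ := hq.exists_setValued_equiv
      obtain ⟨Γ, h⟩ := hq.exists_equiv
      rw [muType, nuType, if_pos hp, if_pos hp]
      exact ⟨Γs, Γ, hs, h⟩
    · have hq := hpav.hasTwoQuotient.2 hp
      obtain ⟨Γs, hs⟩ := hq.exists_setValued_equiv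
      obtain ⟨Γ, h⟩ := hq.exists_equiv
      rw [muType, nuType, if_neg hp, if_neg hp]
      exact ⟨Γs.trans (Equiv.prodComm _ _), Γ.trans (Equiv.prodComm _ _),
        fun T k => (hs T k).symm, fun S k => (h S k).symm⟩
  obtain ⟨Γs, Γ, hs, h⟩ := hbij
  refine ⟨Γs, Γ, hs, h, fun S => ?_⟩
  obtain ⟨T, hT, hTS, hread⟩ := S.exists_singletons
  refine ⟨T, hT, hTS, ?_, ?_⟩
  · exact SetValuedTableau.entry_eq_singleton fun k => by rw [(hs T k).1, hread, (h S k).1]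
  · exact SetValuedTableau.entry_eq_singleton fun k => by rw [(hs T k).2, hread, (h S k).2]
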